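/- **Theorem 2.1.** Let $G$ be a triangulation of the plane or of the projective plane, that is, a finite simple graph on at least four vertices embedded in the sphere or in the projective plane so that every face (in the plane: including the outer one) is an open disc bounded by a 3-cycle. Then $G$ contains at least one of the configurations $Q_1,\dots,Q_{23}$ listed below. *Configurations and containment.* A configuration is a plane graph $C$ with a function $\delta:V(C)\to\mathbb N$ such that $\delta(v)\ge\deg_C(v)$ for all $v$. The embedded graph $G$ contains $(C,\delta)$ if there is an injective map $h:V(C)\to V(G)$ such that (i) $h(a)h(b)\in E(G)$ for every $ab\in E(C)$; (ii) for every facial walk $a_1\dots a_k$ of $C$ except that of the unbounded face, $h(a_1)\dots h(a_k)$ is a facial walk of $G$; (iii) $\deg_G(h(a))=\delta(a)$ for every $a\in V(C)$. *The list.* Vertices are named by their value of $\delta$; a label $d^-$ means that both values $d$ and $d-1$ are allowed (each choice gives a configuration, and $Q_i$ stands for all of them). A *fan* with hub $u$ and rim path $x_1,\dots,x_m$ consists of the path and all edges $ux_j$; its bounded faces are the triangles $ux_jx_{j+1}$. A *4-wheel* with hub $u$ and rim $x_1,x_2,x_3,x_4$ consists of the 4-cycle $x_1x_2x_3x_4$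 and all edges $ux_j$; its bounded faces are the four triangles at $u$. Pendant vertices have degree one in $C$ and are drawn in the unbounded face. - $Q_1$: a single vertex $3$. - $Q_2$: an edge $4,5^-$. - $Q_3$: a path $4,6,5^-$. - $Q_4$: a path $5,5,5$. - $Q_5$: a path $4,6,6,4$. - $Q_6$: a 4-wheel with hub $4$ and rim $7,7,7^-,6$. - $Q_7$: a fan with hub $4$ and rim path $6,7,6$. - $Q_8$: a fan with hub $5^-$ and rim path $6^-,6^-,6^-$. - $Q_9$: a facial triangle $7,4,6$ and a pendant vertex $4$ at the $7$. - $Q_{10}$: a fan with hub $5$ and rim path $6^-,6^-,7,6^-$. - $Q_{11}$: a star with centre $7$ and leaves $5,5,5,5$. - $Q_{12}$: a star with centre $7$ and leaves $4,5^-,5^-$. - $Q_{13}$: a fan with hub $4$ and rim path $8,7,6$, and pendant vertices $4,4$ at the $8$. - $Q_{14}$: a facial triangle $8,4,6$ and pendant vertices $4,5^-$ at the $8$. - $Q_{15}$: a 4-wheel with hub $4$ and rim $8,7,6,7^-$, and pendant vertices $5^-,5^-$ at the $8$. - $Q_{16}$: a 4-wheel with hub $4$ and rim $8,7,6,6$,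 and a pendant vertex $4$ at the $8$. - $Q_{17}$: a star with centre $8$ and leaves $4,5^-,5^-,5^-$. - $Q_{18}$: a star with centre $8$ and leaves $5,5,5,5,5$. - $Q_{19}$: a facial triangle $9,4,6$ and pendant vertices $4,4,5^-$ at the $9$. - $Q_{20}$: a fan with hub $4$ and rim path $9,7,6$, and pendant vertices $4,4,5^-$ at the $9$. - $Q_{21}$: a 4-wheel with hub $4$ and rim $9,7,6,6$, and pendant vertices $4,5^-$ at the $9$. - $Q_{22}$: a star with centre $9$ and leaves $4,5^-,5^-,5^-,5^-$. - $Q_{23}$: two 4-wheels, each with hub $4$ and rim $10,7,6,6$, sharing exactly the vertex $10$, and a pendant vertex $4$ at the $10$. -/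

import Mathlib

namespace Triang

/-- `G` together with the set `F` of (vertex sets of) facial triangles is a triangulation of a
closed connected surface: `G` is a connected finite simple graph, each face has three vertices,
and around each vertex `v` the neighbours of `v` can be listed in a cyclic order
`c 0, …, c (k - 1)` (`k ≥ 3`, indices mod `k`) such that the faces at `v` are exactly the
triangles `v, c i, c (i + 1)`. -/
structure IsTriangulation {V : Type*} [Fintype V] [DecidableEq V] (G : SimpleGraph V)
    (F : Finset (Finset V)) : Prop where
  connected : G.Connected
  card_face : ∀ f ∈ F, f.card = 3
  rotation : ∀ v : V, ∃ k : ℕ, 3 ≤ k ∧ ∃ c : ZMod k → V, Function.Injective c ∧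
    (∀ x, G.Adj v x ↔ ∃ i, c i = x) ∧
    (∀ x y, ({v, x, y} : Finset V) ∈ F ↔
      ∃ i, (x = c i ∧ y = c (i + 1)) ∨ (y = c i ∧ x = c (i + 1)))

/-- Euler characteristic `|V| - |E| + |F|` of an embedded graph. -/
def eulerChar {V : Type*} [Fintype V] (G : SimpleGraph V) [DecidableRel G.Adj]
    (F : Finset (Finset V)) : ℤ :=
  (Fintype.card V : ℤ) - (G.edgeFinset.card : ℤ) + (F.card : ℤ)

/-- A triangulation of the plane (equivalently of the sphere: the outer face is a face too),
that is, an embedding of Euler genus `0`. -/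
def IsPlaneTriangulation {V : Type*} [Fintype V] [DecidableEq V] (G : SimpleGraph V)
    [DecidableRel G.Adj] (F : Finset (Finset V)) : Prop :=
  IsTriangulation G F ∧ eulerChar G F = 2

/-- A triangulation of the projective plane, that is, an embedding of Euler genus `1`. -/
def IsProjectivePlaneTriangulation {V : Type*} [Fintype V] [DecidableEq V] (G : SimpleGraph V)
    [DecidableRel G.Adj] (F : Finset (Finset V)) : Prop :=
  IsTriangulation G F ∧ eulerChar G F = 1

/-- The facial walks of a triangulation (written without repeating the starting vertex):
the face `{a, b, c}`, traversed from any starting vertex in either direction. -/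
def IsFacialWalk {V : Type*} [DecidableEq V] (F : Finset (Finset V)) (w : List V) : Prop :=
  ∃ a b c : V, w = [a, b, c] ∧ ({a, b, c} : Finset V) ∈ F

/-- Combinatorial data of a finite plane graph on the vertices `0, …, order - 1`: its edges, each
listed once, and for every face except the unbounded one a facial walk. -/
structure PlaneGraph where
  order : ℕ
  edges : List (Fin order × Fin order)
  boundedFaces : List (List (Fin order))

/-- The degree of a vertex of a plane graph. -/
def PlaneGraph.degree (C : PlaneGraph) (a : Fin C.order) : ℕ :=
  (C.edges.filter fun e => e.1 = a ∨ e.2 = a).length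

/-- The triangulation `(G, F)` contains the configuration `(C, δ)`. -/
def Contains {V : Type*} [Fintype V] [DecidableEq V] (G : SimpleGraph V) [DecidableRel G.Adj]
    (F : Finset (Finset V)) (C : PlaneGraph) (δ : Fin C.order → ℕ) : Prop :=
  ∃ h : Fin C.order → V, Function.Injective h ∧
    (∀ e ∈ C.edges, G.Adj (h e.1) (h e.2)) ∧
    (∀ w ∈ C.boundedFaces, IsFacialWalk F (w.map h)) ∧
    (∀ a, G.degree (h a) = δ a)

/-- A drawing in which every vertex carries a label, i.e. a set of values allowed for `δ`. It
stands for all configurations `(C, δ)` with `δ a ∈ label a` for each vertex `a`. -/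
structure Drawing extends PlaneGraph where
  label : Fin order → Finset ℕ
  degree_le : ∀ a, ∀ d ∈ label a, toPlaneGraph.degree a ≤ d

/-- Some configuration represented by the drawing `Q` is contained in the triangulation. -/
def ContainsDrawing {V : Type*} [Fintype V] [DecidableEq V] (G : SimpleGraph V)
    [DecidableRel G.Adj] (F : Finset (Finset V)) (Q : Drawing) : Prop :=
  ∃ δ : Fin Q.order → ℕ, (∀ a, δ a ∈ Q.label a) ∧ Contains G F Q.toPlaneGraph δ

/-- The label `d`: the degree is exactly `d`. -/
def ex (d : ℕ) : Finset ℕ := {d}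

/-- The label `d⁻`: the degree is `d` or `d - 1`. -/
def lo (d : ℕ) : Finset ℕ := {d, d - 1}

/-- A single 3-vertex. -/
def Q1 : Drawing where
  order := 1
  edges := []
  boundedFaces := []
  label := ![ex 3]
  degree_le := by decide

/-- An edge `4, 5⁻`. -/
def Q2 : Drawing where
  order := 2
  edges := [(0, 1)]
  boundedFaces := []
  label := ![ex 4, lo 5]
  degree_le := by decide

/-- A path `4, 6, 5⁻`. -/
def Q3 : Drawing where
  order := 3
  edges := [(0, 1), (1, 2)]
  boundedFaces := []
  label := ![ex 4, ex 6, lo 5]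
  degree_le := by decide

/-- A path `5, 5, 5`. -/
def Q4 : Drawing where
  order := 3
  edges := [(0, 1), (1, 2)]
  boundedFaces := []
  label := ![ex 5, ex 5, ex 5]
  degree_le := by decide

/-- A path `4, 6, 6, 4`. -/
def Q5 : Drawing where
  order := 4
  edges := [(0, 1), (1, 2), (2, 3)]
  boundedFaces := []
  label := ![ex 4, ex 6, ex 6, ex 4]
  degree_le := by decide

/-- A 4-wheel with hub 4 and rim `7, 7, 7⁻, 6`. -/
def Q6 : Drawing where
  order := 5
  edges := [(0, 1), (0, 2), (0, 3), (0, 4), (1, 2), (2, 3), (3, 4), (4, 1)]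
  boundedFaces := [[0, 1, 2], [0, 2, 3], [0, 3, 4], [0, 4, 1]]
  label := ![ex 4, ex 7, ex 7, lo 7, ex 6]
  degree_le := by decide

/-- A fan with hub 4 and rim path `6, 7, 6`. -/
def Q7 : Drawing where
  order := 4
  edges := [(0, 1), (0, 2), (0, 3), (1, 2), (2, 3)]
  boundedFaces := [[0, 1, 2], [0, 2, 3]]
  label := ![ex 4, ex 6, ex 7, ex 6]
  degree_le := by decide

/-- A fan with hub `5⁻` and rim path `6⁻, 6⁻, 6⁻`. -/
def Q8 : Drawing where
  order := 4
  edges := [(0, 1), (0, 2), (0, 3), (1, 2), (2, 3)]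
  boundedFaces := [[0, 1, 2], [0, 2, 3]]
  label := ![lo 5, lo 6, lo 6, lo 6]
  degree_le := by decide

/-- A triangle `7, 4, 6` with a pendant 4-vertex attached to the 7-vertex. -/
def Q9 : Drawing where
  order := 4
  edges := [(0, 1), (0, 2), (1, 2), (0, 3)]
  boundedFaces := [[0, 1, 2]]
  label := ![ex 7, ex 4, ex 6, ex 4]
  degree_le := by decide

/-- A fan with hub 5 and rim path `6⁻, 6⁻, 7, 6⁻`. -/
def Q10 : Drawing where
  order := 5
  edges := [(0, 1), (0, 2), (0, 3), (0, 4), (1, 2), (2, 3), (3, 4)]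
  boundedFaces := [[0, 1, 2], [0, 2, 3], [0, 3, 4]]
  label := ![ex 5, lo 6, lo 6, ex 7, lo 6]
  degree_le := by decide

/-- A star with centre 7 and leaves `5, 5, 5, 5`. -/
def Q11 : Drawing where
  order := 5
  edges := [(0, 1), (0, 2), (0, 3), (0, 4)]
  boundedFaces := []
  label := ![ex 7, ex 5, ex 5, ex 5, ex 5]
  degree_le := by decide

/-- A star with centre 7 and leaves `4, 5⁻, 5⁻`. -/
def Q12 : Drawing where
  order := 4
  edges := [(0, 1), (0, 2), (0, 3)]
  boundedFaces := []
  label := ![ex 7, ex 4, lo 5, lo 5]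
  degree_le := by decide

/-- An 8-vertex `0`, a 4-vertex `1`, a 7-vertex `2` and a 6-vertex `3` forming the two triangles
`0 1 2` and `1 2 3`, and two pendant 4-vertices at the 8-vertex. -/
def Q13 : Drawing where
  order := 6
  edges := [(0, 1), (0, 2), (1, 2), (1, 3), (2, 3), (0, 4), (0, 5)]
  boundedFaces := [[0, 1, 2], [1, 2, 3]]
  label := ![ex 8, ex 4, ex 7, ex 6, ex 4, ex 4]
  degree_le := by decide

/-- A triangle `8, 4, 6` with pendant vertices `4, 5⁻` at the 8-vertex. -/
def Q14 : Drawing where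
  order := 5
  edges := [(0, 1), (0, 2), (1, 2), (0, 3), (0, 4)]
  boundedFaces := [[0, 1, 2]]
  label := ![ex 8, ex 4, ex 6, ex 4, lo 5]
  degree_le := by decide

/-- A 4-wheel with hub 4 and rim `8, 7, 6, 7⁻`, and two pendant vertices `5⁻, 5⁻` at the
8-vertex. -/
def Q15 : Drawing where
  order := 7
  edges := [(0, 1), (0, 2), (0, 3), (0, 4), (1, 2), (2, 3), (3, 4), (4, 1), (1, 5), (1, 6)]
  boundedFaces := [[0, 1, 2], [0, 2, 3], [0, 3, 4], [0, 4, 1]]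
  label := ![ex 4, ex 8, ex 7, ex 6, lo 7, lo 5, lo 5]
  degree_le := by decide

/-- A 4-wheel with hub 4 and rim `8, 7, 6, 6`, and a pendant 4-vertex at the 8-vertex. -/
def Q16 : Drawing where
  order := 6
  edges := [(0, 1), (0, 2), (0, 3), (0, 4), (1, 2), (2, 3), (3, 4), (4, 1), (1, 5)]
  boundedFaces := [[0, 1, 2], [0, 2, 3], [0, 3, 4], [0, 4, 1]]
  label := ![ex 4, ex 8, ex 7, ex 6, ex 6, ex 4]
  degree_le := by decide

/-- A star with centre 8 and leaves `4, 5⁻, 5⁻, 5⁻`. -/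
def Q17 : Drawing where
  order := 5
  edges := [(0, 1), (0, 2), (0, 3), (0, 4)]
  boundedFaces := []
  label := ![ex 8, ex 4, lo 5, lo 5, lo 5]
  degree_le := by decide

/-- A star with centre 8 and leaves `5, 5, 5, 5, 5`. -/
def Q18 : Drawing where
  order := 6
  edges := [(0, 1), (0, 2), (0, 3), (0, 4), (0, 5)]
  boundedFaces := []
  label := ![ex 8, ex 5, ex 5, ex 5, ex 5, ex 5]
  degree_le := by decide

/-- A triangle `9, 4, 6` with pendant vertices `4, 4, 5⁻` at the 9-vertex. -/
def Q19 : Drawing where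
  order := 6
  edges := [(0, 1), (0, 2), (1, 2), (0, 3), (0, 4), (0, 5)]
  boundedFaces := [[0, 1, 2]]
  label := ![ex 9, ex 4, ex 6, ex 4, ex 4, lo 5]
  degree_le := by decide

/-- A 9-vertex `0`, a 4-vertex `1`, a 7-vertex `2` and a 6-vertex `3` forming the two triangles
`0 1 2` and `1 2 3`, and pendant vertices `4, 4, 5⁻` at the 9-vertex. -/
def Q20 : Drawing where
  order := 7
  edges := [(0, 1), (0, 2), (1, 2), (1, 3), (2, 3), (0, 4), (0, 5), (0, 6)]
  boundedFaces := [[0, 1, 2], [1, 2, 3]]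
  label := ![ex 9, ex 4, ex 7, ex 6, ex 4, ex 4, lo 5]
  degree_le := by decide

/-- A 4-wheel with hub 4 and rim `9, 7, 6, 6`, and pendant vertices `4, 5⁻` at the 9-vertex. -/
def Q21 : Drawing where
  order := 7
  edges := [(0, 1), (0, 2), (0, 3), (0, 4), (1, 2), (2, 3), (3, 4), (4, 1), (1, 5), (1, 6)]
  boundedFaces := [[0, 1, 2], [0, 2, 3], [0, 3, 4], [0, 4, 1]]
  label := ![ex 4, ex 9, ex 7, ex 6, ex 6, ex 4, lo 5]
  degree_le := by decide

/-- A star with centre 9 and leaves `4, 5⁻, 5⁻, 5⁻, 5⁻`. -/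
def Q22 : Drawing where
  order := 6
  edges := [(0, 1), (0, 2), (0, 3), (0, 4), (0, 5)]
  boundedFaces := []
  label := ![ex 9, ex 4, lo 5, lo 5, lo 5, lo 5]
  degree_le := by decide

/-- Two 4-wheels with hubs 4 and rims `10, 7, 6, 6` that share exactly their 10-vertex `0`, and a
pendant 4-vertex at the 10-vertex. -/
def Q23 : Drawing where
  order := 10
  edges := [(1, 0), (1, 2), (1, 3), (1, 4), (0, 2), (2, 3), (3, 4), (4, 0),
    (5, 0), (5, 6), (5, 7), (5, 8), (0, 6), (6, 7), (7, 8), (8, 0), (0, 9)]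
  boundedFaces := [[1, 0, 2], [1, 2, 3], [1, 3, 4], [1, 4, 0],
    [5, 0, 6], [5, 6, 7], [5, 7, 8], [5, 8, 0]]
  label := ![ex 10, ex 4, ex 7, ex 6, ex 6, ex 4, ex 7, ex 6, ex 6, ex 4]
  degree_le := by decide

/-- The list of the 23 configurations. -/
def unavoidable : List Drawing :=
  [Q1, Q2, Q3, Q4, Q5, Q6, Q7, Q8, Q9, Q10, Q11, Q12, Q13, Q14, Q15, Q16, Q17, Q18, Q19, Q20,
    Q21, Q22, Q23]

end Triang

namespace Triang

open Finset

/-! The proof is by discharging. Suppose that none of the configurations occurs and give each vertex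
`v` the charge `60 * (deg v - 6)`. By Euler's formula (`sum_degree_sub_six`) the total is `-360`
times the Euler characteristic. Each vertex of degree at least 7 then hands `gift G F v x` to its
neighbours `x` of degree 4 or 5, which leaves the total unchanged. If all final charges are
nonnegative (`charge_nonneg`), then the Euler characteristic is at most 0, whereas it is 2 for the
plane and 1 for the projective plane.

The gifts are large enough: a 4-vertex lacks 120 and a 5-vertex lacks 60, and `four_receives` and
`five_receives` show that they get it, because the rims on which they would get less contain `Q6`,
`Q7`, `Q8` or `Q10`.

The gifts are affordable. For degrees 7, 8 and 9 the star configurations bound the number of low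
neighbours, and the configurations with a face or a wheel lower the largest gift when there are many
of them. For degree at least 10, and for degree 9 without 4-neighbours, the gifts are spread over
the cyclic list of neighbours (`LinkData`) until every slot carries about the same load. A slot may
carry 27 when the degree is at least 11 but only 24 on average at degree 10; there the excess caused
by gifts of 80 is matched with lightly loaded slots, and `Q23` limits how many such gifts occur. -/

/-- Degrees and gifts along the cyclic list of neighbours of a vertex, with the local
restrictions that they satisfy when no configuration of the list occurs. -/
structure LinkData {d : ℕ} (D : ZMod d → ℕ) (γ : ZMod d → ℤ) : Prop where
  four_le : ∀ i, 4 ≤ D i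
  four_adj : ∀ i, D i = 4 → 6 ≤ D (i + 1) ∧ 6 ≤ D (i - 1)
  four_six : ∀ i, D i = 4 → (D (i + 1) = 6 → 6 ≤ D (i + 2)) ∧ (D (i - 1) = 6 → 6 ≤ D (i - 2))
  five : ∀ i, D i = 5 → ¬ (D (i + 1) = 5 ∧ D (i - 1) = 5)
  four_six_six : ∀ i, D i = 4 → D (i + 1) = 6 → D (i + 2) = 6 → D (i + 3) ≠ 4
  gift_six : ∀ i, 6 ≤ D i → γ i ≤ 0
  gift_five : ∀ i, D i = 5 → γ i ≤ 20 ∨ (γ i ≤ 30 ∧ D (i + 1) ≤ 6 ∧ D (i - 1) ≤ 6)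
  gift_four : ∀ i, D i = 4 → γ i ≤ 40 ∨ (γ i ≤ 60 ∧ (D (i + 1) = 6 ∨ D (i - 1) = 6)) ∨
    (γ i = 80 ∧ D (i + 1) = 6 ∧ D (i - 1) = 7 ∧ D (i - 2) ≠ 4) ∨
    (γ i = 80 ∧ D (i - 1) = 6 ∧ D (i + 1) = 7 ∧ D (i + 2) ≠ 4)

/-! ### Redistribution of gifts along the cycle of neighbours. -/

namespace LinkData

variable {d : ℕ} {D : ZMod d → ℕ} {γ : ZMod d → ℤ}

theorem neg (h : LinkData D γ) : LinkData (fun i => D (-i)) (fun i => γ (-i)) := by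
  have e1 : ∀ i : ZMod d, -(i + 1) = -i - 1 := fun i => by ring
  have e2 : ∀ i : ZMod d, -(i - 1) = -i + 1 := fun i => by ring
  have e3 : ∀ i : ZMod d, -(i + 2) = -i - 2 := fun i => by ring
  have e4 : ∀ i : ZMod d, -(i - 2) = -i + 2 := fun i => by ring
  refine ⟨fun i => h.four_le _, fun i hi => ?_, fun i hi => ?_, fun i hi => ?_,
    fun i h0 h1 h2 h3 => ?_, fun i hi => h.gift_six _ hi, fun i hi => ?_, fun i hi => ?_⟩
  · rw [e1, e2]; exact (h.four_adj _ hi).symm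
  · rw [e1, e2, e3, e4]; exact (h.four_six _ hi).symm
  · rw [e1, e2]; exact fun hh => h.five _ hi hh.symm
  · refine h.four_six_six (-(i + 3)) h3 ?_ ?_ ?_
    · convert h2 using 2; ring
    · convert h1 using 2; ring
    · convert h0 using 2; ring
  · rw [e1, e2]
    rcases h.gift_five _ hi with hh | ⟨a, b, c⟩
    · exact Or.inl hh
    · exact Or.inr ⟨a, c, b⟩
  · rw [e1, e2, e3, e4]
    have := h.gift_four _ hi
    tauto

/-- Redistribution along a cycle. -/
theorem sum_le_sum_load [NeZero d] (γ keep up down : ZMod d → ℤ)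
    (h : ∀ i, γ i ≤ keep i + up i + down i) :
    ∑ i, γ i ≤ ∑ i, (keep i + up (i - 1) + down (i + 1)) := by
  have h1 : ∑ i, up (i - 1) = ∑ i, up i := Equiv.sum_comp (Equiv.subRight (1 : ZMod d)) up
  have h2 : ∑ i, down (i + 1) = ∑ i, down i := Equiv.sum_comp (Equiv.addRight (1 : ZMod d)) down
  rw [Finset.sum_add_distrib, Finset.sum_add_distrib, h1, h2, ← Finset.sum_add_distrib,
    ← Finset.sum_add_distrib]
  exact Finset.sum_le_sum fun i _ => h i

/-- A 5-slot with a gift above 20 has both neighbours of degree 5 or 6, and not both 5. It keeps 20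
and passes 10 to each adjacent 6-slot, which thus carries at most 20. -/
theorem sum_le_of_no_four [NeZero d] (h : LinkData D γ) (h4 : ∀ i, D i ≠ 4) :
    ∑ i, γ i ≤ 20 * d := by
  refine (sum_le_sum_load γ (fun i => if D i = 5 then 20 else 0)
    (fun i => if D i = 5 ∧ D (i + 1) = 6 then 10 else 0)
    (fun i => if D i = 5 ∧ D (i - 1) = 6 then 10 else 0) fun i => ?_).trans ?_
  · have := h.four_le i
    have := h.four_le (i + 1)
    have := h.four_le (i - 1)
    have := h4 i
    have := h4 (i + 1)
    have := h4 (i - 1)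
    have a := h.gift_six i
    have b := h.gift_five i
    have c := h.five i
    split_ifs <;> omega
  · calc _ ≤ ∑ i : ZMod d, (20 : ℤ) := Finset.sum_le_sum fun i _ => by
          simp only [sub_add_cancel, add_sub_cancel_right]
          split_ifs <;> omega
      _ = _ := by simp [ZMod.card, mul_comm]

/-- What slot `i` of degree `a` sends to a neighbouring slot of degree `b`. -/
def send (t : ℤ) (a b : ℕ) (g : ℤ) : ℤ :=
  if a = 4 then (if b = 6 then t else if 7 ≤ b then (if g = 80 then 80 - 2 * t else 12) else 0)
  else if a = 5 ∧ b = 6 then 6 else 0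

/-- The load of slot `i`: what it keeps and what it receives from the neighbouring slots. -/
def load (D : ZMod d → ℕ) (γ : ZMod d → ℤ) (t : ℤ) (i : ZMod d) : ℤ :=
  (if D i ≤ 5 then t else 0) + send t (D (i - 1)) (D i) (γ (i - 1)) +
    send t (D (i + 1)) (D i) (γ (i + 1))

/-- Every slot can pay its gift from what it keeps and sends. A gift of 80 is split as `t + t + (80
- 2 * t)` over itself, the 6 and the 7; a gift of 60 needs `2 * t + 12 ≥ 60`, and a 5-slot with 30
needs `t + 6 ≥ 30`. Both force `24 ≤ t`. -/
theorem sum_le_load [NeZero d] (h : LinkData D γ) {t : ℤ} (ht : 24 ≤ t) (ht' : t ≤ 27) :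
    ∑ i, γ i ≤ ∑ i, load D γ t i := by
  have key := sum_le_sum_load γ (fun i => if D i ≤ 5 then t else 0)
    (fun i => send t (D i) (D (i + 1)) (γ i)) (fun i => send t (D i) (D (i - 1)) (γ i))
    fun i => ?_
  · simpa only [load, sub_add_cancel, add_sub_cancel_right] using key
  · have := h.four_le i
    have := h.four_le (i + 1)
    have := h.four_le (i - 1)
    have a := h.gift_six i
    have b := h.gift_five i
    have c := h.five i
    have e := h.gift_four i
    have f := h.four_adj i
    have f1 := h.four_adj (i + 1)
    have f2 := h.four_adj (i - 1)
    rw [add_sub_cancel_right] at f1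
    rw [sub_add_cancel] at f2
    dsimp only [send]
    split_ifs <;> omega

/-- Slot `i` is the 7-vertex at a slot which gets `80`. -/
def Heavy (D : ZMod d → ℕ) (γ : ZMod d → ℤ) (i : ZMod d) : Prop :=
  D i = 7 ∧ (γ (i - 1) = 80 ∨ γ (i + 1) = 80)

theorem eq_four_of_gift (h : LinkData D γ) {i : ZMod d} (hi : γ i = 80) : D i = 4 := by
  have := h.four_le i
  have := h.gift_six i
  have := h.gift_five i
  omega

/-- Slots of degree 4 or 5 receive nothing. A 6-slot that gets `t` from a 4 has no low neighbour on
its other side. A slot of degree at least 7 gets at most `12 + 12`, except from a gift of 80, and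
then its other neighbour is not a 4. -/
theorem load_bound (h : LinkData D γ) {t : ℤ} (ht : 24 ≤ t) (ht' : t ≤ 27) (i : ZMod d) :
    load D γ t i ≤ t ∨ (Heavy D γ i ∧ load D γ t i ≤ 80 - 2 * t) := by
  have p1 : i - 1 + 1 = i := by ring
  have p2 : i + 1 - 1 = i := by ring
  have p3 : i - 1 + 2 = i + 1 := by ring
  have p4 : i + 1 - 2 = i - 1 := by ring
  have a1 := h.four_adj (i + 1)
  have a2 := h.four_adj (i - 1)
  have b1 := h.four_six (i + 1)
  have b2 := h.four_six (i - 1)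
  have c1 := h.gift_four (i + 1)
  have c2 := h.gift_four (i - 1)
  rw [p2] at a1 b1 c1
  rw [p1] at a2 b2 c2
  rw [p4] at b1 c1
  rw [p3] at b2 c2
  have := h.four_le i
  unfold load send Heavy
  split_ifs <;> omega

/-- With `t = 27` heavy slots carry only `80 - 54 = 26`, and `27 * d ≤ 60 * (d - 6)` holds from `d =
11` on. -/
theorem sum_le_of_eleven_le [NeZero d] (h : LinkData D γ) (hd : 11 ≤ d) :
    ∑ i, γ i ≤ 60 * ((d : ℤ) - 6) := by
  refine (h.sum_le_load (t := 27) (by norm_num) le_rfl).trans ?_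
  calc _ ≤ ∑ i : ZMod d, (27 : ℤ) := Finset.sum_le_sum fun i _ => by
        rcases h.load_bound (t := 27) (by norm_num) le_rfl i with hh | ⟨_, hh⟩ <;> omega
    _ = 27 * d := by simp [ZMod.card, mul_comm]
    _ ≤ _ := by omega

/-- The slot beyond the 6-vertex next to a 4-vertex has a small load. -/
theorem load_beyond (h : LinkData D γ) {p : ZMod d} (hp : D p = 4) (hp1 : D (p + 1) = 6)
    (hH : ¬ Heavy D γ (p + 2)) :
    load D γ 24 (p + 2) ≤ 12 ∧ (load D γ 24 (p + 2) ≤ 6 ∨ (D (p + 3) = 4 ∧ 7 ≤ D (p + 2))) := by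
  have p1 : p + 2 - 1 = p + 1 := by ring
  have p2 : p + 2 + 1 = p + 3 := by ring
  have p3 : p + 3 - 1 = p + 2 := by ring
  -- Slot `p + 2` has degree at least 6 and the 6-slot `p + 1` sends nothing, so all load comes from
  -- `p + 3`. A 4 there is impossible if `p + 2` has degree 6, and otherwise sends 12, since a gift
  -- of 80 would make `p + 2` heavy.
  have a := (h.four_six p hp).1 hp1
  have b := h.four_six_six p hp hp1
  have c := h.gift_four (p + 3)
  have e := h.four_le (p + 3)
  unfold Heavy at hH
  rw [p1, p2] at hH
  rw [p3] at c
  unfold load send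
  rw [p1, p2]
  split_ifs <;> omega

/-- At `t = 24` a heavy slot carries 32, an excess of 8, which a single light slot `x` has to make
up for. -/
theorem sum_le_of_improved [NeZero d] (h : LinkData D γ) {S : Finset (ZMod d)}
    (hS : ∀ i, Heavy D γ i → i ∈ S) {x : ZMod d} {b : ℤ} (hx : load D γ 24 x ≤ b) (hxS : x ∉ S) :
    ∑ i, γ i ≤ 24 * d + 8 * (S.card : ℤ) + b - 24 := by
  classical
  refine (h.sum_le_load (t := 24) le_rfl (by norm_num)).trans ?_
  calc _ ≤ ∑ i : ZMod d, (24 + (if i ∈ S then 8 else 0) + (if i = x then b - 24 else 0)) :=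
        Finset.sum_le_sum fun i _ => by
          by_cases hi : i = x
          · subst hi; simp [hxS]; exact hx
          · rcases h.load_bound (t := 24) le_rfl (by norm_num) i with hh | ⟨hH, hh⟩
            · simp only [hi, if_false]; split_ifs <;> omega
            · simp only [hi, if_false, hS i hH, if_true]; omega
    _ = _ := by
        simp [Finset.sum_add_distrib, ZMod.card]
        ring

/-- The budget is 24 per slot. The hypothesis `hQ`, which comes from `Q23`, says that once two slots
get 80 there is no further 4, so at most two gifts of 80 occur. -/
theorem sum_le_ten_of_six {D : ZMod 10 → ℕ} {γ : ZMod 10 → ℤ} (h : LinkData D γ)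
    (hQ : ∀ i j l, γ i = 80 → γ j = 80 → i ≠ j → D l = 4 → l = i ∨ l = j)
    {p : ZMod 10} (hp : γ p = 80) (hp1 : D (p + 1) = 6) :
    ∑ i, γ i ≤ 240 := by
  have hp4 := h.eq_four_of_gift hp
  have n1 : ∀ i : ZMod 10, i + 2 ≠ i - 1 := by decide
  have n2 : ∀ i : ZMod 10, i + 3 ≠ i := by decide
  have n3 : ∀ i : ZMod 10, i + 6 ≠ i := by decide
  have n4 : ∀ i : ZMod 10, i + 6 ≠ i + 3 := by decide
  have n5 : ∀ i : ZMod 10, i + 3 + 2 ≠ i - 1 := by decide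
  have n6 : ∀ i : ZMod 10, i + 3 + 2 ≠ i + 2 := by decide
  have notSix : ∀ i, D i = 6 → γ i ≠ 80 := fun i hi hg => by
    have := h.eq_four_of_gift hg; omega
  have hbey := h.load_beyond hp4 hp1
  by_cases hq : ∃ q, q ≠ p ∧ γ q = 80
  · obtain ⟨q, hqp, hq⟩ := hq
    have all : ∀ l, D l = 4 → l = p ∨ l = q := fun l hl => hQ p q l hp hq hqp.symm hl
    have hpq : γ (p + 3) = 80 → p + 3 = q := fun hg =>
      (all _ (h.eq_four_of_gift hg)).resolve_left (n2 p)
    -- Two heavy slots have excess 16, so a slot with load at most 6 suffices. It is `p + 2`, unless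
    -- that slot is heavy; then the second gift of 80 is at `p + 3` with its 6 at `p + 4`, and `p +
    -- 5` serves.
    by_cases hH : Heavy D γ (p + 2)
    · have e1 : p + 2 - 1 = p + 1 := by ring
      have e2 : p + 2 + 1 = p + 3 := by ring
      have e3 : p + 3 - 1 = p + 2 := by ring
      obtain ⟨hH7, hH'⟩ := hH
      rw [e1, e2] at hH'
      have hq3 : γ (p + 3) = 80 := hH'.resolve_left (notSix _ hp1)
      have hq' := hpq hq3
      have hq4 := h.eq_four_of_gift hq3
      have g := h.gift_four _ hq4
      rw [e3] at g
      have hq6 : D (p + 3 + 1) = 6 := by omega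
      have e4 : p + 3 + 2 - 1 = p + 3 + 1 := by ring
      have e5 : p + 3 + 2 + 1 = p + 6 := by ring
      have e6 : p + 3 + 3 = p + 6 := by ring
      have n46 : D (p + 6) ≠ 4 := fun h4 => by
        rcases all _ h4 with hh | hh
        · exact n3 _ hh
        · exact n4 _ (hh.trans hq'.symm)
      have hH' : ¬ Heavy D γ (p + 3 + 2) := by
        rintro ⟨_, hh⟩
        rw [e4, e5] at hh
        rcases hh with hh | hh
        · exact notSix _ hq6 hh
        · exact n46 (h.eq_four_of_gift hh)
      have hl : load D γ 24 (p + 3 + 2) ≤ 6 := by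
        rcases (h.load_beyond hq4 hq6 hH').2 with hh | ⟨hh, _⟩
        · exact hh
        · rw [e6] at hh; exact absurd hh n46
      have hS : ∀ i, Heavy D γ i → i ∈ ({p - 1, p + 2} : Finset (ZMod 10)) := by
        rintro i ⟨hi7, hi⟩
        simp only [mem_insert, mem_singleton]
        have key : ∀ j, γ j = 80 → j = p ∨ j = p + 3 := fun j hj => by
          rw [hq']; exact all j (h.eq_four_of_gift hj)
        rcases hi with hi | hi
        · rcases key _ hi with hh | hh
          · rw [sub_eq_iff_eq_add] at hh; subst hh; omega
          · rw [sub_eq_iff_eq_add] at hh; subst hh; omega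
        · rcases key _ hi with hh | hh
          · left; rw [← hh]; ring
          · right; rw [← e3, ← hh]; ring
      have := h.sum_le_of_improved hS hl (by
        simp only [mem_insert, mem_singleton, not_or]; exact ⟨n5 p, n6 p⟩)
      have hc := Finset.card_le_two (a := p - 1) (b := p + 2)
      push_cast at this
      omega
    · have hl : load D γ 24 (p + 2) ≤ 6 := by
        rcases (hbey hH).2 with hh | ⟨hh, hh7⟩
        · exact hh
        -- A 4 at `p + 3` would be the second slot with gift 80, which makes its neighbour `p + 2`,
        -- of degree at least 7, heavy.
        · have hq' := (all _ hh).resolve_left (n2 p)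
          have g := h.gift_four _ hh
          have e3 : p + 3 - 1 = p + 2 := by ring
          have e2 : p + 2 + 1 = p + 3 := by ring
          rw [e3, hq', hq] at g
          exact absurd ⟨by omega, Or.inr (by rw [e2, hq', hq])⟩ hH
      obtain ⟨S, hS, hc⟩ : ∃ S : Finset (ZMod 10), (∀ i, Heavy D γ i ↔ i ∈ S) ∧ S.card ≤ 2 := by
        classical
        -- Each gift of 80 creates only one heavy slot, its other neighbour having degree 6.
        obtain ⟨r, hr⟩ : ∃ r, ∀ i, Heavy D γ i → i = p - 1 ∨ i = r := by
          have gq := h.gift_four q (h.eq_four_of_gift hq)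
          have key : ∀ i, Heavy D γ i → i = p - 1 ∨ i = q - 1 ∨ i = q + 1 := by
            rintro i ⟨hi7, hi | hi⟩
            · rcases all _ (h.eq_four_of_gift hi) with hh | hh
              · rw [sub_eq_iff_eq_add] at hh; subst hh; omega
              · right; right; rw [← hh]; ring
            · rcases all _ (h.eq_four_of_gift hi) with hh | hh
              · left; rw [← hh]; ring
              · right; left; rw [← hh]; ring
          by_cases h6 : D (q + 1) = 6
          · refine ⟨q - 1, fun i hi => ?_⟩
            rcases key i hi with hh | hh | hh
            · exact Or.inl hh
            · exact Or.inr hh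
            · have := hi.1; rw [hh] at this; omega
          · refine ⟨q + 1, fun i hi => ?_⟩
            rcases key i hi with hh | hh | hh
            · exact Or.inl hh
            · have := hi.1; rw [hh] at this; omega
            · exact Or.inr hh
        refine ⟨Finset.univ.filter (Heavy D γ), by simp, ?_⟩
        refine (Finset.card_le_card (t := {p - 1, r}) fun i hi => ?_).trans Finset.card_le_two
        have := hr i (by simpa using hi)
        simpa using this
      have := h.sum_le_of_improved (fun i hi => (hS i).1 hi) hl (fun hh => hH ((hS _).2 hh))
      push_cast at this
      omega
  · push Not at hq
    -- With a single gift of 80 the excess is 8, and the load 12 at `p + 2` already saves 12.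
    have hS : ∀ i, Heavy D γ i → i ∈ ({p - 1} : Finset (ZMod 10)) := by
      rintro i ⟨hi7, hi | hi⟩
      · have hh : i - 1 = p := by_contra fun hne => hq _ hne hi
        rw [sub_eq_iff_eq_add] at hh; subst hh; omega
      · have hh : i + 1 = p := by_contra fun hne => hq _ hne hi
        rw [mem_singleton, ← hh]; ring
    have hx : p + 2 ∉ ({p - 1} : Finset (ZMod 10)) := by
      rw [mem_singleton]; exact n1 p
    have := h.sum_le_of_improved hS (hbey fun hH => hx (hS _ hH)).1 hx
    simp only [card_singleton] at this
    push_cast at this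
    omega

/-- The 6 beside a gift of 80 may be on either side; `neg` reflects the cycle to bring it to `p +
1`. -/
theorem sum_le_ten {D : ZMod 10 → ℕ} {γ : ZMod 10 → ℤ} (h : LinkData D γ)
    (hQ : ∀ i j l, γ i = 80 → γ j = 80 → i ≠ j → D l = 4 → l = i ∨ l = j) :
    ∑ i, γ i ≤ 240 := by
  by_cases hp : ∃ p, γ p = 80
  · obtain ⟨p, hp⟩ := hp
    have g := h.gift_four p (h.eq_four_of_gift hp)
    rw [hp] at g
    by_cases h6 : D (p + 1) = 6
    · exact h.sum_le_ten_of_six hQ hp h6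
    · have e1 : -(-p + 1) = p - 1 := by ring
      have := h.neg.sum_le_ten_of_six (p := -p) (fun i j l hi hj hij hl => by
          rcases hQ _ _ _ hi hj (fun hh => hij (neg_injective hh)) hl with hh | hh
          · exact Or.inl (neg_injective hh)
          · exact Or.inr (neg_injective hh)) (by rw [neg_neg]; exact hp)
          (by rw [e1]; omega)
      rwa [show ∑ i, γ (-i) = ∑ i, γ i from Equiv.sum_comp (Equiv.neg (ZMod 10)) γ] at this
  · push Not at hp
    refine (h.sum_le_load (t := 24) le_rfl (by norm_num)).trans ?_
    calc _ ≤ ∑ i : ZMod 10, (24 : ℤ) := Finset.sum_le_sum fun i _ => by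
          rcases h.load_bound (t := 24) le_rfl (by norm_num) i with hh | ⟨⟨_, hh | hh⟩, _⟩
          · exact hh
          · exact absurd hh (hp _)
          · exact absurd hh (hp _)
      _ = _ := by simp [ZMod.card]

end LinkData

set_option linter.unusedSectionVars false

/-! ### Rotations, faces at a vertex, and Euler's formula. -/

section Rotation

variable {V : Type*} [Fintype V] [DecidableEq V] {G : SimpleGraph V} [DecidableRel G.Adj]
  {F : Finset (Finset V)}

/-- `c` lists the neighbours of `v` in the cyclic order given by the faces at `v`. -/
structure IsRotation (G : SimpleGraph V) (F : Finset (Finset V)) (v : V) {d : ℕ}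
    (c : ZMod d → V) : Prop where
  injective : Function.Injective c
  adj_iff : ∀ x, G.Adj v x ↔ ∃ i, c i = x
  face_iff : ∀ i w, ({v, c i, w} : Finset V) ∈ F ↔ w = c (i + 1) ∨ w = c (i - 1)
  exists_of_face : ∀ x y, ({v, x, y} : Finset V) ∈ F → ∃ i, x = c i

theorem IsTriangulation.exists_rotation (hT : IsTriangulation G F) (v : V) {d : ℕ}
    (hd : G.degree v = d) : 3 ≤ d ∧ ∃ c : ZMod d → V, IsRotation G F v c := by
  obtain ⟨k, hk, c, hc, hadj, hF⟩ := hT.rotation v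
  have : NeZero k := ⟨by omega⟩
  have hdeg : G.degree v = k := by
    rw [← G.card_neighborFinset_eq_degree, show G.neighborFinset v = univ.image c by
      ext x; simp [hadj], card_image_of_injective _ hc, card_univ, ZMod.card]
  obtain rfl : d = k := hd.symm.trans hdeg
  refine ⟨hk, c, hc, hadj, fun i w => ?_, fun x y h => ?_⟩
  · rw [hF]
    constructor
    · rintro ⟨j, ⟨h1, h2⟩ | ⟨h1, h2⟩⟩
      · obtain rfl := hc h1
        exact Or.inl h2
      · obtain rfl := hc h2
        exact Or.inr (by rw [h1, add_sub_cancel_right])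
    · rintro (rfl | rfl)
      · exact ⟨i, Or.inl ⟨rfl, rfl⟩⟩
      · exact ⟨i - 1, Or.inr ⟨rfl, by rw [sub_add_cancel]⟩⟩
  · obtain ⟨i, ⟨h1, _⟩ | ⟨_, h1⟩⟩ := (hF x y).1 h
    · exact ⟨i, h1⟩
    · exact ⟨i + 1, h1⟩

namespace IsRotation

variable {v : V} {d : ℕ} {c : ZMod d → V}

theorem adj (h : IsRotation G F v c) (i : ZMod d) : G.Adj v (c i) := (h.adj_iff _).2 ⟨i, rfl⟩

theorem ne (h : IsRotation G F v c) {i j : ZMod d} (hij : i ≠ j) : c i ≠ c j :=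
  fun hh => hij (h.injective hh)

theorem face (h : IsRotation G F v c) (i : ZMod d) : ({v, c i, c (i + 1)} : Finset V) ∈ F :=
  (h.face_iff i _).2 (Or.inl rfl)

theorem sum_neighborFinset [NeZero d] (h : IsRotation G F v c) (f : V → ℤ) :
    ∑ x ∈ G.neighborFinset v, f x = ∑ i, f (c i) := by
  rw [show G.neighborFinset v = univ.image c by ext x; simp [h.adj_iff],
    sum_image fun i _ j _ hij => h.injective hij]

end IsRotation

theorem face_swap {v x y : V} (h : ({v, x, y} : Finset V) ∈ F) : ({x, v, y} : Finset V) ∈ F := by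
  rwa [Finset.insert_comm]

theorem face_swap' {v x y : V} (h : ({v, x, y} : Finset V) ∈ F) : ({v, y, x} : Finset V) ∈ F := by
  rwa [Finset.pair_comm]

theorem IsTriangulation.adj_of_face (hT : IsTriangulation G F) {v x y : V}
    (h : ({v, x, y} : Finset V) ∈ F) : G.Adj v x := by
  obtain ⟨_, c, hc⟩ := hT.exists_rotation v rfl
  obtain ⟨i, rfl⟩ := hc.exists_of_face _ _ h
  exact hc.adj i

theorem IsTriangulation.adj_of_face' (hT : IsTriangulation G F) {v x y : V}
    (h : ({v, x, y} : Finset V) ∈ F) : G.Adj x y :=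
  hT.adj_of_face (y := v) (face_swap' (face_swap h))

theorem two_ne_zero_zmod {d : ℕ} (hd : 3 ≤ d) : (2 : ZMod d) ≠ 0 := by
  intro h
  have := (ZMod.natCast_eq_zero_iff 2 d).1 (by exact_mod_cast h)
  exact absurd (Nat.le_of_dvd (by norm_num) this) (by omega)

theorem IsTriangulation.card_faces_at (hT : IsTriangulation G F) (v : V) :
    (F.filter (v ∈ ·)).card = G.degree v := by
  obtain ⟨hd, c, hc⟩ := hT.exists_rotation v rfl
  have : NeZero (G.degree v) := ⟨by omega⟩
  have hv : ∀ i, c i ≠ v := fun i hi => (hc.adj i).ne hi.symm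
  have h2 := two_ne_zero_zmod hd
  conv_rhs => rw [← ZMod.card (G.degree v), ← card_univ]
  symm
  refine card_bij (fun i _ => {v, c i, c (i + 1)}) (fun i _ => by simp [hc.face]) ?_ ?_
  · intro i _ j _ hij
    have e1 : c i ∈ ({v, c j, c (j + 1)} : Finset V) := by rw [← hij]; simp
    have e2 : c (i + 1) ∈ ({v, c j, c (j + 1)} : Finset V) := by rw [← hij]; simp
    simp only [mem_insert, mem_singleton, hv, false_or, hc.injective.eq_iff] at e1 e2
    rcases e1 with e1 | e1
    · exact e1
    · rcases e2 with e2 | e2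
      -- Equal faces with the two rim vertices interchanged would give `j + 2 = j`, impossible for
      -- degree at least 3.
      · exfalso
        apply h2
        have : j + 2 = j := by linear_combination e2 - e1
        simpa using this
      · exact add_right_cancel e2
  · intro f hf
    rw [mem_filter] at hf
    have hcard := hT.card_face f hf.1
    have h' : (f.erase v).card = 2 := by rw [card_erase_of_mem hf.2, hcard]
    obtain ⟨x, y, _, hxy⟩ := card_eq_two.1 h'
    have hfe : f = {v, x, y} := by rw [← insert_erase hf.2, hxy]
    have hfF := hf.1
    rw [hfe] at hfF
    obtain ⟨i, rfl⟩ := hc.exists_of_face _ _ hfF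
    rcases (hc.face_iff _ _).1 hfF with rfl | rfl
    · exact ⟨i, mem_univ _, hfe.symm⟩
    · refine ⟨i - 1, mem_univ _, ?_⟩
      rw [sub_add_cancel, hfe, Finset.pair_comm]

/-- Euler's formula as a sum of degrees. -/
theorem IsTriangulation.sum_degree_sub_six (hT : IsTriangulation G F) :
    ∑ v, ((G.degree v : ℤ) - 6) = -6 * eulerChar G F := by
  have h1 : ∑ v, G.degree v = 2 * G.edgeFinset.card := G.sum_degrees_eq_twice_card_edges
  -- Incident pairs of a vertex and a face are counted in two ways.
  have h2 : ∑ v, G.degree v = 3 * F.card := by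
    calc _ = ∑ v, (F.filter (v ∈ ·)).card := sum_congr rfl fun v _ => (hT.card_faces_at v).symm
      _ = ∑ v, ∑ f ∈ F, if v ∈ f then 1 else 0 := by simp only [card_filter]
      _ = ∑ f ∈ F, f.card := by
          rw [sum_comm]; exact sum_congr rfl fun f _ => by simp
      _ = _ := by rw [sum_congr rfl hT.card_face]; simp [mul_comm]
  have h3 : ∑ v, (G.degree v : ℤ) = 2 * (G.edgeFinset.card : ℤ) := by exact_mod_cast h1
  have h4 : ∑ v, (G.degree v : ℤ) = 3 * (F.card : ℤ) := by exact_mod_cast h2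
  rw [sum_sub_distrib, sum_const, card_univ, eulerChar, nsmul_eq_mul]
  linarith

end Rotation
-- What the absence of each configuration forbids.
section Free

variable {V : Type*} [Fintype V] [DecidableEq V] {G : SimpleGraph V} [DecidableRel G.Adj]
  {F : Finset (Finset V)}

/-- A triangulation which contains none of the configurations. -/
structure IsFree (G : SimpleGraph V) [DecidableRel G.Adj] (F : Finset (Finset V)) : Prop where
  tri : IsTriangulation G F
  free : ∀ Q ∈ unavoidable, ¬ ContainsDrawing G F Q

theorem isFacialWalk_of_mem {a b c : V} (h : ({a, b, c} : Finset V) ∈ F) :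
    IsFacialWalk F [a, b, c] := ⟨a, b, c, rfl, h⟩

theorem mem_ex {n d : ℕ} (h : n = d) : n ∈ ex d := by simp [ex, h]

theorem mem_lo {n d : ℕ} (h : d ≤ n + 1) (h' : n ≤ d) : n ∈ lo d := by
  simp only [lo, mem_insert, mem_singleton]; omega

namespace IsFree

/-- Taking the actual degrees for `δ` makes the degree condition trivial. `List.Forall` unfolds to a
conjunction on concrete lists, so adjacencies and faces can be supplied as tuples. -/
theorem elim (h : IsFree G F) {Q : Drawing} (hQ : Q ∈ unavoidable) (f : Fin Q.order → V)
    (hf : (List.ofFn f).Nodup) (he : Q.edges.Forall fun e => G.Adj (f e.1) (f e.2))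
    (hF : Q.boundedFaces.Forall fun w => IsFacialWalk F (w.map f))
    (hl : ∀ a, G.degree (f a) ∈ Q.label a) : False :=
  h.free Q hQ ⟨fun a => G.degree (f a), hl, f, List.nodup_ofFn.1 hf,
    List.forall_iff_forall_mem.1 he, List.forall_iff_forall_mem.1 hF, fun _ => rfl⟩

theorem four_le (h : IsFree G F) (v : V) : 4 ≤ G.degree v := by
  have h3 := (h.tri.exists_rotation v rfl).1
  by_contra hlt
  refine h.elim (Q := Q1) (by simp [unavoidable]) ![v] ?_ trivial trivial ?_
  · exact List.nodup_singleton v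
  · have hv : G.degree v = 3 := by omega
    intro a
    fin_cases a
    exact mem_ex hv

theorem low (h : IsFree G F) {v : V} (hv : G.degree v ≤ 5) : G.degree v ∈ lo 5 :=
  mem_lo (by have := h.four_le v; omega) hv

theorem six_le_of_adj_four (h : IsFree G F) {x y : V} (hx : G.degree x = 4) (hxy : G.Adj x y) :
    6 ≤ G.degree y := by
  have := h.four_le y
  by_contra hlt
  have hy : G.degree y ∈ lo 5 := mem_lo (by omega) (by omega)
  refine h.elim (Q := Q2) (by simp [unavoidable]) ![x, y] ?_ hxy trivial ?_
  · show [x, y].Nodup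
    simpa using hxy.ne
  · intro a
    fin_cases a
    exacts [mem_ex hx, hy]

theorem no_path_four_six_low (h : IsFree G F) {x y z : V} (hx : G.degree x = 4)
    (hy : G.degree y = 6) (hz : G.degree z ≤ 5) (hxy : G.Adj x y) (hyz : G.Adj y z)
    (hxz : x ≠ z) : False := by
  refine h.elim (Q := Q3) (by simp [unavoidable]) ![x, y, z] ?_ ⟨hxy, hyz⟩ trivial ?_
  · show [x, y, z].Nodup
    grind
  · intro a
    fin_cases a
    exacts [mem_ex hx, mem_ex hy, h.low hz]

theorem no_path_five (h : IsFree G F) {x y z : V} (hx : G.degree x = 5)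
    (hy : G.degree y = 5) (hz : G.degree z = 5) (hxy : G.Adj x y) (hyz : G.Adj y z)
    (hxz : x ≠ z) : False := by
  refine h.elim (Q := Q4) (by simp [unavoidable]) ![x, y, z] ?_ ⟨hxy, hyz⟩ trivial ?_
  · show [x, y, z].Nodup
    have := hxy.ne
    have := hyz.ne
    grind
  · intro a
    fin_cases a
    exacts [mem_ex hx, mem_ex hy, mem_ex hz]

theorem no_path_four_six_six_four (h : IsFree G F) {x y z w : V} (hx : G.degree x = 4)
    (hy : G.degree y = 6) (hz : G.degree z = 6) (hw : G.degree w = 4) (hxy : G.Adj x y)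
    (hyz : G.Adj y z) (hzw : G.Adj z w) (hxw : x ≠ w) : False := by
  refine h.elim (Q := Q5) (by simp [unavoidable]) ![x, y, z, w] ?_ ⟨hxy, hyz, hzw⟩ trivial ?_
  · show [x, y, z, w].Nodup
    have := hyz.ne
    grind
  · intro a
    fin_cases a
    exacts [mem_ex hx, mem_ex hy, mem_ex hz, mem_ex hw]

/-- A label `6⁻` allows 5 and 6 only; this excludes 4 for neighbours of a low vertex. -/
theorem five_le_of_adj_low (h : IsFree G F) {x y : V} (hx : G.degree x ≤ 5) (hxy : G.Adj x y) :
    5 ≤ G.degree y := by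
  have := h.four_le y
  by_contra hlt
  have := h.six_le_of_adj_four (x := y) (y := x) (by omega) hxy.symm
  omega

/-- Only `p ≠ r` must be assumed: all other pairs are adjacent or differ in degree. -/
theorem no_wheel_seven_seven_seven_six (h : IsFree G F) {x p q r s : V} (hx : G.degree x = 4)
    (hp : G.degree p = 7) (hq : G.degree q = 7) (hr : 6 ≤ G.degree r) (hr' : G.degree r ≤ 7)
    (hs : G.degree s = 6) (f1 : {x, p, q} ∈ F) (f2 : {x, q, r} ∈ F) (f3 : {x, r, s} ∈ F)
    (f4 : {x, s, p} ∈ F) (hpr : p ≠ r) : False := by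
  have hr7 : G.degree r ∈ lo 7 := mem_lo (by omega) hr'
  have a1 := h.tri.adj_of_face' f1
  have a2 := h.tri.adj_of_face' f2
  have a3 := h.tri.adj_of_face' f3
  have a4 := h.tri.adj_of_face' f4
  refine h.elim (Q := Q6) (by simp [unavoidable]) ![x, p, q, r, s] ?_
    ⟨h.tri.adj_of_face f1, h.tri.adj_of_face f2, h.tri.adj_of_face f3, h.tri.adj_of_face f4,
      a1, a2, a3, a4⟩
    ⟨isFacialWalk_of_mem f1, isFacialWalk_of_mem f2, isFacialWalk_of_mem f3,
      isFacialWalk_of_mem f4⟩ ?_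
  · show [x, p, q, r, s].Nodup
    have := a1.ne
    have := a2.ne
    have := a3.ne
    simp only [List.nodup_cons, List.mem_cons, List.not_mem_nil, or_false, not_or, List.nodup_nil,
      not_false_eq_true, and_true]
    and_intros <;> first | assumption | exact Ne.symm ‹_› | (rintro rfl; omega)
  · intro a
    fin_cases a
    exacts [mem_ex hx, mem_ex hp, mem_ex hq, hr7, mem_ex hs]

theorem no_fan_six_seven_six (h : IsFree G F) {x p q r : V} (hx : G.degree x = 4)
    (hp : G.degree p = 6) (hq : G.degree q = 7) (hr : G.degree r = 6)
    (f1 : {x, p, q} ∈ F) (f2 : {x, q, r} ∈ F) (hpr : p ≠ r) : False := by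
  refine h.elim (Q := Q7) (by simp [unavoidable]) ![x, p, q, r] ?_
    ⟨h.tri.adj_of_face f1, h.tri.adj_of_face f2, h.tri.adj_of_face (face_swap' f2),
      h.tri.adj_of_face' f1, h.tri.adj_of_face' f2⟩
    ⟨isFacialWalk_of_mem f1, isFacialWalk_of_mem f2⟩ ?_
  · show [x, p, q, r].Nodup
    grind
  · intro a
    fin_cases a
    exacts [mem_ex hx, mem_ex hp, mem_ex hq, mem_ex hr]

theorem no_fan_of_le_six (h : IsFree G F) {x p q r : V} (hx : G.degree x ≤ 5)
    (hp : G.degree p ≤ 6) (hq : G.degree q ≤ 6) (hr : G.degree r ≤ 6)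
    (f1 : {x, p, q} ∈ F) (f2 : {x, q, r} ∈ F) (hpr : p ≠ r) : False := by
  have a1 := h.tri.adj_of_face f1
  have a2 := h.tri.adj_of_face f2
  have a3 := h.tri.adj_of_face (face_swap' f2)
  have a4 := h.tri.adj_of_face' f1
  have a5 := h.tri.adj_of_face' f2
  have m : ∀ y, G.Adj x y → G.degree y ≤ 6 → G.degree y ∈ lo 6 := fun y hy h6 =>
    mem_lo (by have := h.five_le_of_adj_low hx hy; omega) h6
  have hp6 := m p a1 hp
  have hq6 := m q a2 hq
  have hr6 := m r a3 hr
  refine h.elim (Q := Q8) (by simp [unavoidable]) ![x, p, q, r] ?_ ⟨a1, a2, a3, a4, a5⟩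
    ⟨isFacialWalk_of_mem f1, isFacialWalk_of_mem f2⟩ ?_
  · show [x, p, q, r].Nodup
    have := a1.ne
    have := a2.ne
    have := a3.ne
    have := a4.ne
    have := a5.ne
    grind
  · intro a
    fin_cases a
    exacts [h.low hx, hp6, hq6, hr6]

theorem no_four_at_seven_four_six (h : IsFree G F) {z x w y : V} (hz : G.degree z = 7)
    (hx : G.degree x = 4) (hw : G.degree w = 6) (hy : G.degree y = 4)
    (f : {z, x, w} ∈ F) (hzy : G.Adj z y) (hxy : x ≠ y) : False := by
  refine h.elim (Q := Q9) (by simp [unavoidable]) ![z, x, w, y] ?_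
    ⟨h.tri.adj_of_face f, h.tri.adj_of_face (face_swap' f), h.tri.adj_of_face' f, hzy⟩
    (isFacialWalk_of_mem f) ?_
  · show [z, x, w, y].Nodup
    grind
  · intro a
    fin_cases a
    exacts [mem_ex hz, mem_ex hx, mem_ex hw, mem_ex hy]

theorem no_fan_seven_at_five (h : IsFree G F) {x p q r s : V} (hx : G.degree x = 5)
    (hp : G.degree p ≤ 6) (hq : G.degree q ≤ 6) (hr : G.degree r = 7) (hs : G.degree s ≤ 6)
    (f1 : {x, p, q} ∈ F) (f2 : {x, q, r} ∈ F) (f3 : {x, r, s} ∈ F) (hps : p ≠ s)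
    (hqs : q ≠ s) : False := by
  have a1 := h.tri.adj_of_face f1
  have a2 := h.tri.adj_of_face f2
  have a3 := h.tri.adj_of_face f3
  have a4 := h.tri.adj_of_face (face_swap' f3)
  have a5 := h.tri.adj_of_face' f1
  have m : ∀ y, G.Adj x y → G.degree y ≤ 6 → G.degree y ∈ lo 6 := fun y hy h6 =>
    mem_lo (by have := h.five_le_of_adj_low hx.le hy; omega) h6
  have hp6 := m p a1 hp
  have hq6 := m q a2 hq
  have hs6 := m s a4 hs
  refine h.elim (Q := Q10) (by simp [unavoidable]) ![x, p, q, r, s] ?_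
    ⟨a1, a2, a3, a4, a5, h.tri.adj_of_face' f2, h.tri.adj_of_face' f3⟩
    ⟨isFacialWalk_of_mem f1, isFacialWalk_of_mem f2, isFacialWalk_of_mem f3⟩ ?_
  · show [x, p, q, r, s].Nodup
    have := a1.ne
    have := a2.ne
    have := a4.ne
    have := a5.ne
    simp only [List.nodup_cons, List.mem_cons, List.not_mem_nil, or_false, not_or, List.nodup_nil,
      not_false_eq_true, and_true]
    and_intros <;> first | assumption | exact Ne.symm ‹_› | (rintro rfl; omega)
  · intro a
    fin_cases a
    exacts [mem_ex hx, hp6, hq6, mem_ex hr, hs6]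

theorem exists_fin_of_card {s : Finset V} {n : ℕ} (hn : n ≤ s.card) :
    ∃ f : Fin n → V, Function.Injective f ∧ ∀ i, f i ∈ s := by
  obtain ⟨t, hts, rfl⟩ := exists_subset_card_eq hn
  exact ⟨fun i => t.equivFin.symm i, fun i j hij => by
    simpa using Subtype.ext hij, fun i => hts (t.equivFin.symm i).2⟩

theorem card_five_at_seven (h : IsFree G F) {v : V} (hv : G.degree v = 7) {s : Finset V}
    (hs : ∀ x ∈ s, G.Adj v x ∧ G.degree x = 5) : s.card ≤ 3 := by
  by_contra hc
  obtain ⟨f, hf, hfs⟩ := exists_fin_of_card (s := s) (n := 4) (by omega)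
  have m := fun i => (hs _ (hfs i)).2
  have a := fun i => (hs _ (hfs i)).1
  refine h.elim (Q := Q11) (by simp [unavoidable]) (Fin.cons v f) ?_
    ⟨a 0, a 1, a 2, a 3⟩ trivial ?_
  · refine List.nodup_ofFn.2 (Fin.cons_injective_iff.2 ⟨?_, hf⟩)
    rintro ⟨i, rfl⟩
    exact (a i).ne rfl
  · refine Fin.cases (mem_ex hv) fun i => ?_
    fin_cases i
    exacts [mem_ex (m 0), mem_ex (m 1), mem_ex (m 2), mem_ex (m 3)]

theorem card_five_at_eight (h : IsFree G F) {v : V} (hv : G.degree v = 8) {s : Finset V}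
    (hs : ∀ x ∈ s, G.Adj v x ∧ G.degree x = 5) : s.card ≤ 4 := by
  by_contra hc
  obtain ⟨f, hf, hfs⟩ := exists_fin_of_card (s := s) (n := 5) (by omega)
  have m := fun i => (hs _ (hfs i)).2
  have a := fun i => (hs _ (hfs i)).1
  refine h.elim (Q := Q18) (by simp [unavoidable]) (Fin.cons v f) ?_
    ⟨a 0, a 1, a 2, a 3, a 4⟩ trivial ?_
  · refine List.nodup_ofFn.2 (Fin.cons_injective_iff.2 ⟨?_, hf⟩)
    rintro ⟨i, rfl⟩
    exact (a i).ne rfl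
  · refine Fin.cases (mem_ex hv) fun i => ?_
    fin_cases i
    exacts [mem_ex (m 0), mem_ex (m 1), mem_ex (m 2), mem_ex (m 3), mem_ex (m 4)]

theorem injective_star {n : ℕ} {v x : V} {f : Fin n → V} (hf : Function.Injective f)
    (hv : ∀ i, G.Adj v (f i)) (hx : ∀ i, f i ≠ x) (hvx : G.Adj v x) :
    (List.ofFn (Fin.cons v (Fin.cons x f : Fin (n + 1) → V) : Fin (n + 2) → V)).Nodup := by
  refine List.nodup_ofFn.2 (Fin.cons_injective_iff.2 ⟨?_, Fin.cons_injective_iff.2 ⟨?_, hf⟩⟩)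
  · rintro ⟨i, hi⟩
    revert hi
    refine Fin.cases (fun hi => hvx.ne hi.symm) (fun j hj => (hv j).ne hj.symm) i
  · rintro ⟨i, hi⟩
    exact hx i hi

/-- The vertex `x` serves as the leaf 4, so it is kept out of the set that supplies the leaves `5⁻`.
-/
theorem card_low_at_seven (h : IsFree G F) {v x : V} (hv : G.degree v = 7) (hx : G.degree x = 4)
    (hvx : G.Adj v x) {s : Finset V} (hs : ∀ y ∈ s, G.Adj v y ∧ G.degree y ≤ 5) (hxs : x ∉ s) :
    s.card ≤ 1 := by
  by_contra hc
  obtain ⟨f, hf, hfs⟩ := exists_fin_of_card (s := s) (n := 2) (by omega)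
  have m := fun i => h.low (hs _ (hfs i)).2
  have a := fun i => (hs _ (hfs i)).1
  refine h.elim (Q := Q12) (by simp [unavoidable])
    (Fin.cons v (Fin.cons x f : Fin 3 → V) : Fin 4 → V)
    (injective_star hf a (fun i hi => hxs (hi ▸ hfs i)) hvx) ⟨hvx, a 0, a 1⟩ trivial ?_
  refine Fin.cases (mem_ex hv) (Fin.cases (mem_ex hx) fun i => ?_)
  fin_cases i
  exacts [m 0, m 1]

theorem card_low_at_eight (h : IsFree G F) {v x : V} (hv : G.degree v = 8) (hx : G.degree x = 4)
    (hvx : G.Adj v x) {s : Finset V} (hs : ∀ y ∈ s, G.Adj v y ∧ G.degree y ≤ 5) (hxs : x ∉ s) :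
    s.card ≤ 2 := by
  by_contra hc
  obtain ⟨f, hf, hfs⟩ := exists_fin_of_card (s := s) (n := 3) (by omega)
  have m := fun i => h.low (hs _ (hfs i)).2
  have a := fun i => (hs _ (hfs i)).1
  refine h.elim (Q := Q17) (by simp [unavoidable])
    (Fin.cons v (Fin.cons x f : Fin 4 → V) : Fin 5 → V)
    (injective_star hf a (fun i hi => hxs (hi ▸ hfs i)) hvx) ⟨hvx, a 0, a 1, a 2⟩ trivial ?_
  refine Fin.cases (mem_ex hv) (Fin.cases (mem_ex hx) fun i => ?_)
  fin_cases i
  exacts [m 0, m 1, m 2]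

theorem card_low_at_nine (h : IsFree G F) {v x : V} (hv : G.degree v = 9) (hx : G.degree x = 4)
    (hvx : G.Adj v x) {s : Finset V} (hs : ∀ y ∈ s, G.Adj v y ∧ G.degree y ≤ 5) (hxs : x ∉ s) :
    s.card ≤ 3 := by
  by_contra hc
  obtain ⟨f, hf, hfs⟩ := exists_fin_of_card (s := s) (n := 4) (by omega)
  have m := fun i => h.low (hs _ (hfs i)).2
  have a := fun i => (hs _ (hfs i)).1
  refine h.elim (Q := Q22) (by simp [unavoidable])
    (Fin.cons v (Fin.cons x f : Fin 5 → V) : Fin 6 → V)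
    (injective_star hf a (fun i hi => hxs (hi ▸ hfs i)) hvx) ⟨hvx, a 0, a 1, a 2, a 3⟩ trivial ?_
  refine Fin.cases (mem_ex hv) (Fin.cases (mem_ex hx) fun i => ?_)
  fin_cases i
  exacts [m 0, m 1, m 2, m 3]

theorem no_eight_four_six (h : IsFree G F) {v x w y z : V} (hv : G.degree v = 8)
    (hx : G.degree x = 4) (hw : G.degree w = 6) (f : {v, x, w} ∈ F)
    (hy : G.degree y = 4) (hvy : G.Adj v y) (hz : G.degree z ≤ 5) (hvz : G.Adj v z)
    (hxy : x ≠ y) (hxz : x ≠ z) (hyz : y ≠ z) : False := by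
  refine h.elim (Q := Q14) (by simp [unavoidable]) ![v, x, w, y, z] ?_
    ⟨h.tri.adj_of_face f, h.tri.adj_of_face (face_swap' f), h.tri.adj_of_face' f, hvy, hvz⟩
    (isFacialWalk_of_mem f) ?_
  · show [v, x, w, y, z].Nodup
    simp only [List.nodup_cons, List.mem_cons, List.not_mem_nil, or_false, not_or, List.nodup_nil,
      not_false_eq_true, and_true]
    and_intros <;> first | assumption | exact Ne.symm ‹_› | (rintro rfl; omega)
  · intro a
    fin_cases a
    exacts [mem_ex hv, mem_ex hx, mem_ex hw, mem_ex hy, h.low hz]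

theorem no_nine_four_six (h : IsFree G F) {v x w y y' z : V} (hv : G.degree v = 9)
    (hx : G.degree x = 4) (hw : G.degree w = 6) (f : {v, x, w} ∈ F)
    (hy : G.degree y = 4) (hvy : G.Adj v y) (hy' : G.degree y' = 4) (hvy' : G.Adj v y')
    (hz : G.degree z ≤ 5) (hvz : G.Adj v z) (hn : [x, y, y', z].Nodup) : False := by
  refine h.elim (Q := Q19) (by simp [unavoidable]) ![v, x, w, y, y', z] ?_
    ⟨h.tri.adj_of_face f, h.tri.adj_of_face (face_swap' f), h.tri.adj_of_face' f, hvy, hvy', hvz⟩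
    (isFacialWalk_of_mem f) ?_
  · show [v, x, w, y, y', z].Nodup
    simp only [List.nodup_cons, List.mem_cons, List.not_mem_nil, or_false, not_or, List.nodup_nil,
      not_false_eq_true, and_true] at hn ⊢
    obtain ⟨⟨n1, n2, n3⟩, ⟨n4, n5⟩, n6⟩ := hn
    and_intros <;> first | assumption | exact Ne.symm ‹_› | (rintro rfl; omega)
  · intro a
    fin_cases a
    exacts [mem_ex hv, mem_ex hx, mem_ex hw, mem_ex hy, mem_ex hy', h.low hz]

end IsFree

/-- A 4-wheel with hub `x` of degree 4 and rim `v, p, q, r` where `p, q, r` have degrees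
`7, 6, 6`. -/
structure HeavyWheel (G : SimpleGraph V) [DecidableRel G.Adj] (F : Finset (Finset V))
    (v x p q r : V) : Prop where
  hub : G.degree x = 4
  seven : G.degree p = 7
  six : G.degree q = 6
  six' : G.degree r = 6
  face₁ : {x, v, p} ∈ F
  face₂ : {x, p, q} ∈ F
  face₃ : {x, q, r} ∈ F
  face₄ : {x, r, v} ∈ F

namespace IsFree

theorem no_heavyWheel_eight_low (h : IsFree G F) {v x p q r y z : V} (hv : G.degree v = 8)
    (hW : HeavyWheel G F v x p q r) (hy : G.degree y ≤ 5) (hvy : G.Adj v y)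
    (hz : G.degree z ≤ 5) (hvz : G.Adj v z) (hxy : x ≠ y) (hxz : x ≠ z) (hyz : y ≠ z) :
    False := by
  obtain ⟨hx, hp, hq, hr, f1, f2, f3, f4⟩ := hW
  have hr7 : G.degree r ∈ lo 7 := mem_lo (by omega) (by omega)
  have a3 := h.tri.adj_of_face' f3
  refine h.elim (Q := Q15) (by simp [unavoidable]) ![x, v, p, q, r, y, z] ?_
    ⟨h.tri.adj_of_face f1, h.tri.adj_of_face f2, h.tri.adj_of_face f3, h.tri.adj_of_face f4,
      h.tri.adj_of_face' f1, h.tri.adj_of_face' f2, a3, h.tri.adj_of_face' f4, hvy, hvz⟩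
    ⟨isFacialWalk_of_mem f1, isFacialWalk_of_mem f2, isFacialWalk_of_mem f3,
      isFacialWalk_of_mem f4⟩ ?_
  · show [x, v, p, q, r, y, z].Nodup
    have := a3.ne
    simp only [List.nodup_cons, List.mem_cons, List.not_mem_nil, or_false, not_or, List.nodup_nil,
      not_false_eq_true, and_true]
    and_intros <;> first | assumption | exact Ne.symm ‹_› | (rintro rfl; omega)
  · intro a
    fin_cases a
    exacts [mem_ex hx, mem_ex hv, mem_ex hp, mem_ex hq, hr7, h.low hy, h.low hz]

theorem no_heavyWheel_eight_four (h : IsFree G F) {v x p q r y : V} (hv : G.degree v = 8)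
    (hW : HeavyWheel G F v x p q r) (hy : G.degree y = 4) (hvy : G.Adj v y) (hxy : x ≠ y) :
    False := by
  obtain ⟨hx, hp, hq, hr, f1, f2, f3, f4⟩ := hW
  have a3 := h.tri.adj_of_face' f3
  refine h.elim (Q := Q16) (by simp [unavoidable]) ![x, v, p, q, r, y] ?_
    ⟨h.tri.adj_of_face f1, h.tri.adj_of_face f2, h.tri.adj_of_face f3, h.tri.adj_of_face f4,
      h.tri.adj_of_face' f1, h.tri.adj_of_face' f2, a3, h.tri.adj_of_face' f4, hvy⟩
    ⟨isFacialWalk_of_mem f1, isFacialWalk_of_mem f2, isFacialWalk_of_mem f3,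
      isFacialWalk_of_mem f4⟩ ?_
  · show [x, v, p, q, r, y].Nodup
    have := a3.ne
    simp only [List.nodup_cons, List.mem_cons, List.not_mem_nil, or_false, not_or, List.nodup_nil,
      not_false_eq_true, and_true]
    and_intros <;> first | assumption | exact Ne.symm ‹_› | (rintro rfl; omega)
  · intro a
    fin_cases a
    exacts [mem_ex hx, mem_ex hv, mem_ex hp, mem_ex hq, mem_ex hr, mem_ex hy]

theorem no_heavyWheel_nine (h : IsFree G F) {v x p q r y z : V} (hv : G.degree v = 9)
    (hW : HeavyWheel G F v x p q r) (hy : G.degree y = 4) (hvy : G.Adj v y)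
    (hz : G.degree z ≤ 5) (hvz : G.Adj v z) (hxy : x ≠ y) (hxz : x ≠ z) (hyz : y ≠ z) :
    False := by
  obtain ⟨hx, hp, hq, hr, f1, f2, f3, f4⟩ := hW
  have a3 := h.tri.adj_of_face' f3
  refine h.elim (Q := Q21) (by simp [unavoidable]) ![x, v, p, q, r, y, z] ?_
    ⟨h.tri.adj_of_face f1, h.tri.adj_of_face f2, h.tri.adj_of_face f3, h.tri.adj_of_face f4,
      h.tri.adj_of_face' f1, h.tri.adj_of_face' f2, a3, h.tri.adj_of_face' f4, hvy, hvz⟩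
    ⟨isFacialWalk_of_mem f1, isFacialWalk_of_mem f2, isFacialWalk_of_mem f3,
      isFacialWalk_of_mem f4⟩ ?_
  · show [x, v, p, q, r, y, z].Nodup
    have := a3.ne
    simp only [List.nodup_cons, List.mem_cons, List.not_mem_nil, or_false, not_or, List.nodup_nil,
      not_false_eq_true, and_true]
    and_intros <;> first | assumption | exact Ne.symm ‹_› | (rintro rfl; omega)
  · intro a
    fin_cases a
    exacts [mem_ex hx, mem_ex hv, mem_ex hp, mem_ex hq, mem_ex hr, mem_ex hy, h.low hz]

/-- The wheels must meet only in `v`. A common 7-vertex would give `Q9` with the other hub as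
pendant vertex, and a common 6-vertex would give a path 4, 6, 4, that is `Q3`. -/
theorem no_heavyWheels_ten (h : IsFree G F) {v x p q r x' p' q' r' y : V} (hv : G.degree v = 10)
    (hW : HeavyWheel G F v x p q r) (hW' : HeavyWheel G F v x' p' q' r')
    (hy : G.degree y = 4) (hvy : G.Adj v y) (hxx : x ≠ x') (hxy : x ≠ y) (hxy' : x' ≠ y) :
    False := by
  obtain ⟨hx, hp, hq, hr, f1, f2, f3, f4⟩ := hW
  obtain ⟨hx', hp', hq', hr', f1', f2', f3', f4'⟩ := hW'
  have a3 := h.tri.adj_of_face' f3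
  have a3' := h.tri.adj_of_face' f3'
  have hpp : p ≠ p' := by
    rintro rfl
    exact h.no_four_at_seven_four_six hp hx hq hx' (face_swap f2)
      (h.tri.adj_of_face f2').symm hxx
  have six : ∀ w, G.degree w = 6 → G.Adj x w → G.Adj x' w → False := fun w hw h1 h2 =>
    h.no_path_four_six_low hx hw (by omega) h1 h2.symm hxx
  have hqq : q ≠ q' := by
    rintro rfl
    exact six q hq (h.tri.adj_of_face f3) (h.tri.adj_of_face f3')
  have hqr : q ≠ r' := by
    rintro rfl
    exact six q hq (h.tri.adj_of_face f3) (h.tri.adj_of_face f4')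
  have hrq : r ≠ q' := by
    rintro rfl
    exact six r hr (h.tri.adj_of_face f4) (h.tri.adj_of_face f3')
  have hrr : r ≠ r' := by
    rintro rfl
    exact six r hr (h.tri.adj_of_face f4) (h.tri.adj_of_face f4')
  refine h.elim (Q := Q23) (by simp [unavoidable]) ![v, x, p, q, r, x', p', q', r', y] ?_
    ⟨h.tri.adj_of_face f1, h.tri.adj_of_face f2, h.tri.adj_of_face f3, h.tri.adj_of_face f4,
      h.tri.adj_of_face' f1, h.tri.adj_of_face' f2, a3, h.tri.adj_of_face' f4,
      h.tri.adj_of_face f1', h.tri.adj_of_face f2', h.tri.adj_of_face f3', h.tri.adj_of_face f4',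
      h.tri.adj_of_face' f1', h.tri.adj_of_face' f2', a3', h.tri.adj_of_face' f4', hvy⟩
    ⟨isFacialWalk_of_mem f1, isFacialWalk_of_mem f2, isFacialWalk_of_mem f3,
      isFacialWalk_of_mem f4, isFacialWalk_of_mem f1', isFacialWalk_of_mem f2',
      isFacialWalk_of_mem f3', isFacialWalk_of_mem f4'⟩ ?_
  · show [v, x, p, q, r, x', p', q', r', y].Nodup
    have := a3.ne
    have := a3'.ne
    simp only [List.nodup_cons, List.mem_cons, List.not_mem_nil, or_false, not_or, List.nodup_nil,
      not_false_eq_true, and_true]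
    and_intros <;> first | assumption | exact Ne.symm ‹_› | (rintro rfl; omega)
  · intro a
    fin_cases a
    exacts [mem_ex hv, mem_ex hx, mem_ex hp, mem_ex hq, mem_ex hr, mem_ex hx', mem_ex hp',
      mem_ex hq', mem_ex hr', mem_ex hy]

end IsFree
end Free
-- The discharging rule, and what vertices of degree 4 and 5 receive.
section Gift

variable {V : Type*} [Fintype V] [DecidableEq V] (G : SimpleGraph V) [DecidableRel G.Adj]
  (F : Finset (Finset V))

/-- Some vertex of degree `n` lies on a common face with the edge `v x`. -/
def FaceDegree (v x : V) (n : ℕ) : Prop := ∃ w, ({v, x, w} : Finset V) ∈ F ∧ G.degree w = n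

/-- Some neighbour of `x` of degree 6 lies on no common face with the edge `v x`. -/
def OppositeSix (v x : V) : Prop :=
  ∃ w, G.Adj x w ∧ w ≠ v ∧ ({v, x, w} : Finset V) ∉ F ∧ G.degree w = 6

open Classical in
/-- The charge, in units of `1 / 60`, that `v` gives to its neighbour `x`. -/
noncomputable def gift (v x : V) : ℤ :=
  if G.degree x = 4 then
    if 8 ≤ G.degree v then
      if FaceDegree G F v x 6 then
        if FaceDegree G F v x 7 ∧ OppositeSix G F v x then 80 else 60
      else if OppositeSix G F v x ∧ ∀ w, ({v, x, w} : Finset V) ∈ F → G.degree w = 7 then 40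
      else 30
    else if G.degree v = 7 then (if FaceDegree G F v x 6 then 40 else 30)
    else 0
  else if G.degree x = 5 then
    if 8 ≤ G.degree v then
      if ∀ w, ({v, x, w} : Finset V) ∈ F → G.degree w ≤ 6 then 30 else 20
    else if G.degree v = 7 then 20
    else 0
  else 0

variable {G F}

theorem gift_eq_zero_of_six_le {v x : V} (hx : 6 ≤ G.degree x) : gift G F v x = 0 := by
  unfold gift
  rw [if_neg (by omega), if_neg (by omega)]

theorem gift_eq_zero_of_le_six {v x : V} (hv : G.degree v ≤ 6) : gift G F v x = 0 := by
  unfold gift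
  split_ifs <;> omega

theorem gift_five_le {v x : V} (hx : G.degree x = 5) : gift G F v x ≤ 30 := by
  unfold gift
  split_ifs <;> omega

theorem gift_five_le_twenty {v x : V} (hx : G.degree x = 5) (hv : G.degree v = 7) :
    gift G F v x ≤ 20 := by
  unfold gift
  split_ifs <;> omega

theorem gift_le_eighty (v x : V) : gift G F v x ≤ 80 := by
  unfold gift
  split_ifs <;> omega

theorem gift_seven_le {v x : V} (hv : G.degree v = 7) : gift G F v x ≤ 40 := by
  unfold gift
  split_ifs <;> omega

theorem faceDegree_of_gift_seven {v x : V} (hv : G.degree v = 7) (h : 30 < gift G F v x) :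
    FaceDegree G F v x 6 := by
  unfold gift at h
  split_ifs at h <;> first | assumption | omega

theorem faceDegree_of_gift {v x : V} (h : 40 < gift G F v x) : FaceDegree G F v x 6 := by
  unfold gift at h
  split_ifs at h <;> first | assumption | omega

theorem gift_of_sixty_lt {v x : V} (h : 60 < gift G F v x) :
    gift G F v x = 80 ∧ G.degree x = 4 ∧ FaceDegree G F v x 6 ∧ FaceDegree G F v x 7 ∧
      OppositeSix G F v x := by
  unfold gift at h ⊢
  split_ifs at h ⊢ <;> first | omega | simp_all

theorem le_six_of_gift_five {v x : V} (hx : G.degree x = 5) (h : 20 < gift G F v x) :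
    ∀ w, ({v, x, w} : Finset V) ∈ F → G.degree w ≤ 6 := by
  unfold gift at h
  split_ifs at h <;> first | assumption | omega

section Four

variable {x : V} {c : ZMod 4 → V}

theorem IsRotation.face_iff_swap {d : ℕ} {c : ZMod d → V} (hc : IsRotation G F x c) (i : ZMod d)
    (w : V) : ({c i, x, w} : Finset V) ∈ F ↔ w = c (i + 1) ∨ w = c (i - 1) := by
  rw [← hc.face_iff, Finset.insert_comm]

theorem IsRotation.faceDegree_iff {d : ℕ} {c : ZMod d → V} (hc : IsRotation G F x c) (i : ZMod d)
    (n : ℕ) : FaceDegree G F (c i) x n ↔ G.degree (c (i + 1)) = n ∨ G.degree (c (i - 1)) = n := by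
  unfold FaceDegree
  simp only [hc.face_iff_swap, or_and_right, exists_or, exists_eq_left]

theorem IsRotation.oppositeSix_iff (hc : IsRotation G F x c) (i : ZMod 4) :
    OppositeSix G F (c i) x ↔ G.degree (c (i + 2)) = 6 := by
  have z0 : ∀ i : ZMod 4, i + 2 ≠ i := by decide
  have z1 : ∀ i : ZMod 4, i + 2 ≠ i + 1 := by decide
  have z2 : ∀ i : ZMod 4, i + 2 ≠ i - 1 := by decide
  have z3 : ∀ i j : ZMod 4, j ≠ i → j ≠ i + 1 → j ≠ i - 1 → j = i + 2 := by decide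
  unfold OppositeSix
  constructor
  · rintro ⟨w, hw, hwi, hwf, h6⟩
    obtain ⟨j, rfl⟩ := (hc.adj_iff w).1 hw
    rw [hc.face_iff_swap, not_or] at hwf
    rwa [← z3 i j (fun h => hwi (h ▸ rfl)) (fun h => hwf.1 (h ▸ rfl)) (fun h => hwf.2 (h ▸ rfl))]
  · intro h6
    refine ⟨c (i + 2), hc.adj _, hc.ne (z0 i), ?_, h6⟩
    rw [hc.face_iff_swap, not_or]
    exact ⟨hc.ne (z1 i), hc.ne (z2 i)⟩

/-- The gift to a 4-vertex in terms of the degrees of the giving vertex, of its two neighbours on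
the rim, and of the opposite vertex. -/
def giftFour (o l r p : ℕ) : ℤ :=
  if 8 ≤ o then
    if l = 6 ∨ r = 6 then (if (l = 7 ∨ r = 7) ∧ p = 6 then 80 else 60)
    else if p = 6 ∧ l = 7 ∧ r = 7 then 40 else 30
  else if o = 7 then (if l = 6 ∨ r = 6 then 40 else 30) else 0

theorem IsRotation.gift_four (hc : IsRotation G F x c) (hx : G.degree x = 4) (i : ZMod 4) :
    gift G F (c i) x = giftFour (G.degree (c i)) (G.degree (c (i + 1))) (G.degree (c (i - 1)))
      (G.degree (c (i + 2))) := by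
  unfold gift giftFour
  simp only [hx, if_true, hc.faceDegree_iff, hc.oppositeSix_iff, hc.face_iff_swap,
    forall_eq_or_imp, forall_eq]

/-- Without a 6 on the rim each vertex gives at least 30. With one 6 its rim neighbours give at
least 40 each; if both are 7, the opposite vertex cannot be 7 and gives 40, otherwise one of them
gives at least 60. Two opposite 6s leave two givers of 60, as 6, 7, 6 is excluded. Two adjacent 6s
leave `60 + 60` or `80 + 40`, as 7, 7, 6, 6 is excluded. Three 6s are excluded. -/
theorem sum_giftFour {a b c d : ℕ} (ha : 6 ≤ a) (hb : 6 ≤ b) (hc : 6 ≤ c) (hd : 6 ≤ d)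
    (h6 : ∀ p q r s, [p, q, r, s] ∈ [[a, b, c, d], [b, c, d, a], [c, d, a, b], [d, a, b, c]] →
      ¬ (p = 7 ∧ q = 7 ∧ (r = 6 ∨ r = 7) ∧ s = 6) ∧ ¬ (p = 6 ∧ q = 7 ∧ r = 6) ∧
      ¬ (p = 6 ∧ q = 6 ∧ r = 6)) :
    120 ≤ giftFour a b d c + giftFour b c a d + giftFour c d b a + giftFour d a c b := by
  have h1 := h6 a b c d (by simp)
  have h2 := h6 b c d a (by simp)
  have h3 := h6 c d a b (by simp)
  have h4 := h6 d a b c (by simp)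
  clear h6
  -- The rule distinguishes only 6, 7 and larger; writing the latter as `m + 8` lets `simp` decide
  -- every comparison.
  have key : ∀ n : ℕ, 6 ≤ n → n = 6 ∨ n = 7 ∨ ∃ m, n = m + 8 := fun n hn => by
    by_cases n = 6
    · omega
    · by_cases n = 7
      · omega
      · exact Or.inr (Or.inr ⟨n - 8, by omega⟩)
  rcases key a ha with rfl | rfl | ⟨a, rfl⟩ <;> rcases key b hb with rfl | rfl | ⟨b, rfl⟩ <;>
    rcases key c hc with rfl | rfl | ⟨c, rfl⟩ <;> rcases key d hd with rfl | rfl | ⟨d, rfl⟩ <;>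
    simp [giftFour] at h1 h2 h3 h4 ⊢

end Four

theorem IsFree.four_receives (h : IsFree G F) {x : V} (hx : G.degree x = 4) :
    120 ≤ ∑ v ∈ G.neighborFinset x, gift G F v x := by
  obtain ⟨_, c, hc⟩ := h.tri.exists_rotation x hx
  rw [hc.sum_neighborFinset]
  have h6 : ∀ i, 6 ≤ G.degree (c i) := fun i => h.six_le_of_adj_four hx (hc.adj i)
  have face := hc.face
  have key : ∀ i j k l : ZMod 4, j = i + 1 → k = j + 1 → l = k + 1 → i = l + 1 → i ≠ k →
      ¬ (G.degree (c i) = 7 ∧ G.degree (c j) = 7 ∧ (G.degree (c k) = 6 ∨ G.degree (c k) = 7) ∧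
        G.degree (c l) = 6) ∧ ¬ (G.degree (c i) = 6 ∧ G.degree (c j) = 7 ∧ G.degree (c k) = 6) ∧
      ¬ (G.degree (c i) = 6 ∧ G.degree (c j) = 6 ∧ G.degree (c k) = 6) := by
    intro i j k l hij hjk hkl hli hik
    have f1 := face i
    have f2 := face j
    have f3 := face k
    have f4 := face l
    rw [← hij] at f1
    rw [← hjk] at f2
    rw [← hkl] at f3
    rw [← hli] at f4
    have hne := hc.ne hik
    refine ⟨?_, ?_, ?_⟩
    · rintro ⟨h1, h2, h3, h4⟩
      exact h.no_wheel_seven_seven_seven_six hx h1 h2 (by omega) (by omega) h4 f1 f2 f3 f4 hne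
    · rintro ⟨h1, h2, h3⟩
      exact h.no_fan_six_seven_six hx h1 h2 h3 f1 f2 hne
    · rintro ⟨h1, h2, h3⟩
      exact h.no_fan_of_le_six (by omega) h1.le h2.le h3.le f1 f2 hne
  have e : ∑ i, gift G F (c i) x = gift G F (c 0) x + gift G F (c 1) x + gift G F (c 2) x +
      gift G F (c 3) x := Fin.sum_univ_four fun i : ZMod 4 => gift G F (c i) x
  rw [e, hc.gift_four hx, hc.gift_four hx, hc.gift_four hx, hc.gift_four hx]
  refine sum_giftFour (h6 0) (h6 1) (h6 2) (h6 3) fun p q r s hm => ?_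
  simp only [List.mem_cons, List.cons.injEq, List.not_mem_nil, and_true, or_false] at hm
  rcases hm with ⟨rfl, rfl, rfl, rfl⟩ | ⟨rfl, rfl, rfl, rfl⟩ | ⟨rfl, rfl, rfl, rfl⟩ |
    ⟨rfl, rfl, rfl, rfl⟩
  · exact key 0 1 2 3 rfl rfl rfl rfl (by decide)
  · exact key 1 2 3 0 rfl rfl rfl rfl (by decide)
  · exact key 2 3 0 1 rfl rfl rfl rfl (by decide)
  · exact key 3 0 1 2 rfl rfl rfl rfl (by decide)

/-- Three neighbours of degree at least 7 give 20 each. Otherwise at least three have degree at most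
6 and no three of these are consecutive, so they form a pair and a single one, separated by two
vertices. The fan condition makes both separators of degree at least 8, and each gives 30. -/
theorem sum_giftFive {a b c d e : ℕ} {p q r s t : ℤ}
    (ga : 0 ≤ p ∧ (7 ≤ a → 20 ≤ p) ∧ (8 ≤ a → b ≤ 6 → e ≤ 6 → 30 ≤ p))
    (gb : 0 ≤ q ∧ (7 ≤ b → 20 ≤ q) ∧ (8 ≤ b → c ≤ 6 → a ≤ 6 → 30 ≤ q))
    (gc : 0 ≤ r ∧ (7 ≤ c → 20 ≤ r) ∧ (8 ≤ c → d ≤ 6 → b ≤ 6 → 30 ≤ r))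
    (gd : 0 ≤ s ∧ (7 ≤ d → 20 ≤ s) ∧ (8 ≤ d → e ≤ 6 → c ≤ 6 → 30 ≤ s))
    (ge : 0 ≤ t ∧ (7 ≤ e → 20 ≤ t) ∧ (8 ≤ e → a ≤ 6 → d ≤ 6 → 30 ≤ t))
    (l1 : ¬ (a ≤ 6 ∧ b ≤ 6 ∧ c ≤ 6)) (l2 : ¬ (b ≤ 6 ∧ c ≤ 6 ∧ d ≤ 6))
    (l3 : ¬ (c ≤ 6 ∧ d ≤ 6 ∧ e ≤ 6)) (l4 : ¬ (d ≤ 6 ∧ e ≤ 6 ∧ a ≤ 6))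
    (l5 : ¬ (e ≤ 6 ∧ a ≤ 6 ∧ b ≤ 6))
    (f1 : ¬ (a ≤ 6 ∧ b ≤ 6 ∧ c = 7 ∧ d ≤ 6) ∧ ¬ (d ≤ 6 ∧ c ≤ 6 ∧ b = 7 ∧ a ≤ 6))
    (f2 : ¬ (b ≤ 6 ∧ c ≤ 6 ∧ d = 7 ∧ e ≤ 6) ∧ ¬ (e ≤ 6 ∧ d ≤ 6 ∧ c = 7 ∧ b ≤ 6))
    (f3 : ¬ (c ≤ 6 ∧ d ≤ 6 ∧ e = 7 ∧ a ≤ 6) ∧ ¬ (a ≤ 6 ∧ e ≤ 6 ∧ d = 7 ∧ c ≤ 6))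
    (f4 : ¬ (d ≤ 6 ∧ e ≤ 6 ∧ a = 7 ∧ b ≤ 6) ∧ ¬ (b ≤ 6 ∧ a ≤ 6 ∧ e = 7 ∧ d ≤ 6))
    (f5 : ¬ (e ≤ 6 ∧ a ≤ 6 ∧ b = 7 ∧ c ≤ 6) ∧ ¬ (c ≤ 6 ∧ b ≤ 6 ∧ a = 7 ∧ e ≤ 6)) :
    60 ≤ p + q + r + s + t := by
  obtain ⟨p0, p7, p8⟩ := ga
  obtain ⟨q0, q7, q8⟩ := gb
  obtain ⟨r0, r7, r8⟩ := gc
  obtain ⟨s0, s7, s8⟩ := gd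
  obtain ⟨t0, t7, t8⟩ := ge
  have eight : ∀ n : ℕ, ¬ n ≤ 6 → n ≠ 7 → 8 ≤ n := fun n _ _ => by omega
  -- The pair is `a, b`, the single vertex `d`, and the separators are `c` and `e`; the next four
  -- are its rotations.
  have k1 : a ≤ 6 → b ≤ 6 → d ≤ 6 → 60 ≤ r + t := fun ha hb hd => by
    linarith only [r8 (eight c (fun h => l1 ⟨ha, hb, h⟩) fun h => f1.1 ⟨ha, hb, h, hd⟩) hd hb,
      t8 (eight e (fun h => l5 ⟨h, ha, hb⟩) fun h => f4.2 ⟨hb, ha, h, hd⟩) ha hd]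
  have k2 : b ≤ 6 → c ≤ 6 → e ≤ 6 → 60 ≤ s + p := fun hb hc he => by
    linarith only [s8 (eight d (fun h => l2 ⟨hb, hc, h⟩) fun h => f2.1 ⟨hb, hc, h, he⟩) he hc,
      p8 (eight a (fun h => l1 ⟨h, hb, hc⟩) fun h => f5.2 ⟨hc, hb, h, he⟩) hb he]
  have k3 : c ≤ 6 → d ≤ 6 → a ≤ 6 → 60 ≤ t + q := fun hc hd ha => by
    linarith only [t8 (eight e (fun h => l3 ⟨hc, hd, h⟩) fun h => f3.1 ⟨hc, hd, h, ha⟩) ha hd,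
      q8 (eight b (fun h => l2 ⟨h, hc, hd⟩) fun h => f1.2 ⟨hd, hc, h, ha⟩) hc ha]
  have k4 : d ≤ 6 → e ≤ 6 → b ≤ 6 → 60 ≤ p + r := fun hd he hb => by
    linarith only [p8 (eight a (fun h => l4 ⟨hd, he, h⟩) fun h => f4.1 ⟨hd, he, h, hb⟩) hb he,
      r8 (eight c (fun h => l3 ⟨h, hd, he⟩) fun h => f2.2 ⟨he, hd, h, hb⟩) hd hb]
  have k5 : e ≤ 6 → a ≤ 6 → c ≤ 6 → 60 ≤ q + s := fun he ha hc => by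
    linarith only [q8 (eight b (fun h => l5 ⟨he, ha, h⟩) fun h => f5.1 ⟨he, ha, h, hc⟩) hc ha,
      s8 (eight d (fun h => l4 ⟨h, he, ha⟩) fun h => f3.2 ⟨ha, he, h, hc⟩) he hc]
  have key : ∀ (n : ℕ) (g : ℤ), (7 ≤ n → 20 ≤ g) → n ≤ 6 ∨ (7 ≤ n ∧ 20 ≤ g) :=
    fun n g hg => (le_or_gt n 6).imp_right fun hn => ⟨hn, hg hn⟩
  rcases key a p p7 with ha | ⟨ha, _⟩ <;> rcases key b q q7 with hb | ⟨hb, _⟩ <;>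
    rcases key c r r7 with hc | ⟨hc, _⟩ <;> rcases key d s s7 with hd | ⟨hd, _⟩ <;>
    rcases key e t t7 with he | ⟨he, _⟩ <;>
    first
    | exact (l1 ⟨ha, hb, hc⟩).elim
    | exact (l2 ⟨hb, hc, hd⟩).elim
    | exact (l3 ⟨hc, hd, he⟩).elim
    | exact (l4 ⟨hd, he, ha⟩).elim
    | exact (l5 ⟨he, ha, hb⟩).elim
    | linarith only [k1 ha hb hd, p0, q0, s0]
    | linarith only [k2 hb hc he, q0, r0, t0]
    | linarith only [k3 hc hd ha, p0, r0, s0]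
    | linarith only [k4 hd he hb, q0, s0, t0]
    | linarith only [k5 he ha hc, p0, r0, t0]
    | linarith

theorem IsFree.five_receives (h : IsFree G F) {x : V} (hx : G.degree x = 5) :
    60 ≤ ∑ v ∈ G.neighborFinset x, gift G F v x := by
  obtain ⟨_, c, hc⟩ := h.tri.exists_rotation x hx
  rw [hc.sum_neighborFinset]
  have face := hc.face
  have low : ∀ i j k : ZMod 5, j = i + 1 → k = j + 1 → i ≠ k →
      ¬ (G.degree (c i) ≤ 6 ∧ G.degree (c j) ≤ 6 ∧ G.degree (c k) ≤ 6) := by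
    rintro i j k hij hjk hik ⟨h1, h2, h3⟩
    have f1 := face i
    have f2 := face j
    rw [← hij] at f1
    rw [← hjk] at f2
    exact h.no_fan_of_le_six hx.le h1 h2 h3 f1 f2 (hc.ne hik)
  have fan : ∀ i j k l : ZMod 5, j = i + 1 → k = j + 1 → l = k + 1 → i ≠ k → i ≠ l → j ≠ l →
      ¬ (G.degree (c i) ≤ 6 ∧ G.degree (c j) ≤ 6 ∧ G.degree (c k) = 7 ∧ G.degree (c l) ≤ 6) ∧
      ¬ (G.degree (c l) ≤ 6 ∧ G.degree (c k) ≤ 6 ∧ G.degree (c j) = 7 ∧ G.degree (c i) ≤ 6) := by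
    intro i j k l hij hjk hkl hik hil hjl
    have f1 := face i
    have f2 := face j
    have f3 := face k
    rw [← hij] at f1
    rw [← hjk] at f2
    rw [← hkl] at f3
    constructor
    · rintro ⟨h1, h2, h3, h4⟩
      exact h.no_fan_seven_at_five hx h1 h2 h3 h4 f1 f2 f3 (hc.ne hil) (hc.ne hjl)
    · rintro ⟨h1, h2, h3, h4⟩
      exact h.no_fan_seven_at_five hx h1 h2 h3 h4 (face_swap' f3) (face_swap' f2) (face_swap' f1)
        (hc.ne hil.symm) (hc.ne hik.symm)
  have g : ∀ i j k : ZMod 5, j = i + 1 → k = i - 1 → 0 ≤ gift G F (c i) x ∧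
      (7 ≤ G.degree (c i) → 20 ≤ gift G F (c i) x) ∧
      (8 ≤ G.degree (c i) → G.degree (c j) ≤ 6 → G.degree (c k) ≤ 6 →
        30 ≤ gift G F (c i) x) := by
    rintro i j k rfl rfl
    unfold gift
    simp only [hx, hc.face_iff_swap, forall_eq_or_imp, forall_eq]
    rw [if_neg (by norm_num), if_pos trivial]
    split_ifs <;> omega
  have e : ∑ i, gift G F (c i) x = gift G F (c 0) x + gift G F (c 1) x + gift G F (c 2) x +
      gift G F (c 3) x + gift G F (c 4) x :=
    Fin.sum_univ_five fun i : ZMod 5 => gift G F (c i) x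
  rw [e]
  refine sum_giftFive (g 0 1 4 rfl rfl) (g 1 2 0 rfl rfl) (g 2 3 1 rfl rfl) (g 3 4 2 rfl rfl)
    (g 4 0 3 rfl rfl) (low 0 1 2 rfl rfl (by decide)) (low 1 2 3 rfl rfl (by decide))
    (low 2 3 4 rfl rfl (by decide)) (low 3 4 0 rfl rfl (by decide))
    (low 4 0 1 rfl rfl (by decide)) (fan 0 1 2 3 rfl rfl rfl (by decide) (by decide) (by decide))
    (fan 1 2 3 4 rfl rfl rfl (by decide) (by decide) (by decide))
    (fan 2 3 4 0 rfl rfl rfl (by decide) (by decide) (by decide))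
    (fan 3 4 0 1 rfl rfl rfl (by decide) (by decide) (by decide))
    (fan 4 0 1 2 rfl rfl rfl (by decide) (by decide) (by decide))

end Gift
-- What vertices of degree at least 7 give away, and the final charges.
section Charge

variable {V : Type*} [Fintype V] [DecidableEq V] {G : SimpleGraph V} [DecidableRel G.Adj]
  {F : Finset (Finset V)}

theorem gift_nonneg (v x : V) : 0 ≤ gift G F v x := by
  unfold gift
  split_ifs <;> omega

namespace IsFree

theorem exists_heavyWheel (h : IsFree G F) {v x : V} (hvx : G.Adj v x) (hg : 60 < gift G F v x) :
    ∃ p q r, HeavyWheel G F v x p q r := by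
  obtain ⟨_, hx, h6, h7, ho⟩ := gift_of_sixty_lt hg
  obtain ⟨_, c, hc⟩ := h.tri.exists_rotation x hx
  obtain ⟨i, rfl⟩ := (hc.adj_iff v).1 hvx.symm
  rw [hc.faceDegree_iff] at h6 h7
  rw [hc.oppositeSix_iff] at ho
  have z1 : ∀ i : ZMod 4, i + 2 + 1 = i - 1 := by decide
  have f1 := hc.face i
  have f2 := hc.face (i + 1)
  have f3 := hc.face (i + 2)
  have f4 := hc.face (i - 1)
  rw [add_assoc, one_add_one_eq_two] at f2
  rw [z1] at f3
  rw [sub_add_cancel] at f4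
  -- If the 7 precedes `v` on the rim, the wheel is read in the opposite direction.
  rcases h7 with h7 | h7
  · exact ⟨c (i + 1), c (i + 2), c (i - 1), hx, h7, ho, by omega, f1, f2, f3, f4⟩
  · exact ⟨c (i - 1), c (i + 2), c (i + 1), hx, h7, ho, by omega, face_swap' f4, face_swap' f3,
      face_swap' f2, face_swap' f1⟩

theorem natCast_ne_zero_zmod {d n : ℕ} (hn : 0 < n) (hd : n < d) : (n : ZMod d) ≠ 0 := fun h =>
  absurd (Nat.le_of_dvd hn ((ZMod.natCast_eq_zero_iff n d).1 h)) (by omega)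

/-- The local restrictions come from the paths `Q2` to `Q5`, those on gifts from the rule and `Q9`.
The bound on `d` serves to keep slots at distance 2 or 3 distinct. -/
theorem linkData (h : IsFree G F) {v : V} {d : ℕ} (hd : 9 ≤ d) {c : ZMod d → V}
    (hc : IsRotation G F v c) :
    LinkData (fun i => G.degree (c i)) (fun i => gift G F v (c i)) := by
  have z2 : (2 : ZMod d) ≠ 0 := by exact_mod_cast natCast_ne_zero_zmod (n := 2) (by omega) (by omega)
  have z3 : (3 : ZMod d) ≠ 0 := by exact_mod_cast natCast_ne_zero_zmod (n := 3) (by omega) (by omega)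
  have adj : ∀ i j, j = i + 1 → G.Adj (c i) (c j) := by
    rintro i j rfl
    exact h.tri.adj_of_face' (hc.face i)
  have ne2 : ∀ i j, j = i + 2 → c i ≠ c j := by
    rintro i j rfl hh
    exact z2 (by linear_combination -hc.injective hh)
  have fd : ∀ i n, FaceDegree G F v (c i) n →
      G.degree (c (i + 1)) = n ∨ G.degree (c (i - 1)) = n := by
    rintro i n ⟨w, hw, hn⟩
    rcases (hc.face_iff i w).1 hw with rfl | rfl
    · exact Or.inl hn
    · exact Or.inr hn
  -- The 7-vertex `c j` lies in a triangle 7, 4, 6 of the heavy wheel, so a further 4-neighbour `c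
  -- k` would give `Q9`.
  have far : ∀ i j k, (j = i + 1 ∧ k = j + 1 ∨ i = j + 1 ∧ j = k + 1) →
      60 < gift G F v (c i) → G.degree (c j) = 7 →
      (∀ u, ({v, c i, u} : Finset V) ∈ F → G.degree u = 7 → u = c j) → G.degree (c k) ≠ 4 := by
    intro i j k hijk hg h7 hu hk
    obtain ⟨p, q, r, hW⟩ := h.exists_heavyWheel (hc.adj i) hg
    have hp := hu p (face_swap hW.face₁) hW.seven
    have hik : c i ≠ c k := by
      rcases hijk with ⟨rfl, rfl⟩ | ⟨rfl, rfl⟩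
      · exact ne2 _ _ (by ring)
      · exact (ne2 _ _ (by ring)).symm
    have hjk : G.Adj (c j) (c k) := by
      rcases hijk with ⟨_, hh⟩ | ⟨_, hh⟩
      · exact adj _ _ hh
      · exact (adj _ _ hh).symm
    have f := hW.face₂
    rw [hp] at f
    exact h.no_four_at_seven_four_six h7 hW.hub hW.six hk (face_swap f) hjk hik
  refine ⟨fun i => h.four_le _, fun i hi => ⟨?_, ?_⟩, fun i hi => ⟨fun h6 => ?_, fun h6 => ?_⟩,
    fun i hi h5 => ?_, fun i h1 h2 h3 h4 => ?_, fun i hi => (gift_eq_zero_of_six_le hi).le,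
    fun i hi => ?_, fun i hi => ?_⟩
  · exact h.six_le_of_adj_four hi (adj _ _ rfl)
  · exact h.six_le_of_adj_four hi (adj _ _ (by ring)).symm
  · by_contra hlt
    exact h.no_path_four_six_low hi h6 (Nat.le_of_lt_succ (not_le.1 hlt)) (adj _ _ rfl)
      (adj _ _ (by ring)) (ne2 _ _ rfl)
  · by_contra hlt
    exact h.no_path_four_six_low hi h6 (Nat.le_of_lt_succ (not_le.1 hlt))
      (adj _ _ (by ring)).symm (adj _ _ (by ring)).symm (ne2 _ _ (by ring)).symm
  · exact h.no_path_five h5.2 hi h5.1 (adj _ _ (by ring)) (adj _ _ rfl) (ne2 _ _ (by ring))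
  · exact h.no_path_four_six_six_four h1 h2 h3 h4 (adj _ _ rfl) (adj _ _ (by ring))
      (adj _ _ (by ring)) fun hh => z3 (by linear_combination -hc.injective hh)
  · by_cases hg : gift G F v (c i) ≤ 20
    · exact Or.inl hg
    · have := le_six_of_gift_five hi (not_le.1 hg)
      exact Or.inr ⟨gift_five_le hi, this _ ((hc.face_iff _ _).2 (Or.inl rfl)),
        this _ ((hc.face_iff _ _).2 (Or.inr rfl))⟩
  · by_cases hg : gift G F v (c i) ≤ 40
    · exact Or.inl hg
    · by_cases hg' : gift G F v (c i) ≤ 60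
      · exact Or.inr (Or.inl ⟨hg', fd _ _ (faceDegree_of_gift (not_le.1 hg))⟩)
      · rw [not_le] at hg'
        obtain ⟨h80, _, h6, h7, _⟩ := gift_of_sixty_lt hg'
        refine Or.inr (Or.inr ?_)
        by_cases h61 : G.degree (c (i + 1)) = 6
        · have h71 : G.degree (c (i - 1)) = 7 := by have := fd _ _ h7; omega
          refine Or.inl ⟨h80, h61, h71, far i (i - 1) (i - 2) (Or.inr ⟨by ring, by ring⟩) hg' h71
            fun u hu hu7 => ?_⟩
          rcases (hc.face_iff i u).1 hu with rfl | rfl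
          · omega
          · rfl
        · have h62 : G.degree (c (i - 1)) = 6 := by have := fd _ _ h6; omega
          have h71 : G.degree (c (i + 1)) = 7 := by have := fd _ _ h7; omega
          refine Or.inr ⟨h80, h62, h71, far i (i + 1) (i + 2) (Or.inl ⟨by ring, by ring⟩) hg' h71
            fun u hu hu7 => ?_⟩
          rcases (hc.face_iff i u).1 hu with rfl | rfl
          · rfl
          · omega

theorem sum_gift_of_ten_le (h : IsFree G F) {v : V} (hd : 10 ≤ G.degree v) :
    ∑ x ∈ G.neighborFinset v, gift G F v x ≤ 60 * ((G.degree v : ℤ) - 6) := by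
  obtain ⟨d, hdv⟩ : ∃ d, G.degree v = d := ⟨_, rfl⟩
  rw [hdv] at hd ⊢
  obtain ⟨_, c, hc⟩ := h.tri.exists_rotation v hdv
  have : NeZero d := ⟨by omega⟩
  rw [hc.sum_neighborFinset]
  have hl := h.linkData (by omega) hc
  rcases eq_or_lt_of_le hd with rfl | hlt
  · refine (hl.sum_le_ten fun i j l hi hj hij h4 => ?_).trans (by norm_num)
    by_contra hne
    rw [not_or] at hne
    have wheel : ∀ i, gift G F v (c i) = 80 → ∃ p q r, HeavyWheel G F v (c i) p q r := fun i hi =>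
      h.exists_heavyWheel (hc.adj i) (by rw [hi]; norm_num)
    obtain ⟨_, _, _, hW⟩ := wheel i hi
    obtain ⟨_, _, _, hW'⟩ := wheel j hj
    exact h.no_heavyWheels_ten hdv hW hW' h4 (hc.adj l) (hc.ne hij) (hc.ne (Ne.symm hne.1))
      (hc.ne (Ne.symm hne.2))
  · exact hl.sum_le_of_eleven_le hlt

end IsFree

/-- The neighbours of `v` of degree `n`. -/
def neighborsOfDegree (G : SimpleGraph V) [DecidableRel G.Adj] (v : V) (n : ℕ) : Finset V :=
  (G.neighborFinset v).filter fun x => G.degree x = n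

theorem mem_neighborsOfDegree {v x : V} {n : ℕ} :
    x ∈ neighborsOfDegree G v n ↔ G.Adj v x ∧ G.degree x = n := by
  simp [neighborsOfDegree]

namespace IsFree

/-- Reduces degrees 7 and 8, and degree 9 with a 4-neighbour, to arithmetic in the numbers of 4- and
5-neighbours. -/
theorem sum_gift_le (h : IsFree G F) {v : V} {m n : ℤ}
    (hm : ∀ x ∈ neighborsOfDegree G v 4, gift G F v x ≤ m)
    (hn : ∀ x ∈ neighborsOfDegree G v 5, gift G F v x ≤ n) :
    ∑ x ∈ G.neighborFinset v, gift G F v x ≤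
      m * (neighborsOfDegree G v 4).card + n * (neighborsOfDegree G v 5).card := by
  calc _ ≤ ∑ x ∈ G.neighborFinset v,
        ((if G.degree x = 4 then m else 0) + (if G.degree x = 5 then n else 0)) := by
        refine sum_le_sum fun x hx => ?_
        have hvx : G.Adj v x := by simpa using hx
        by_cases h4 : G.degree x = 4
        · simpa [h4] using hm x (mem_neighborsOfDegree.2 ⟨hvx, h4⟩)
        · by_cases h5 : G.degree x = 5
          · simpa [h5] using hn x (mem_neighborsOfDegree.2 ⟨hvx, h5⟩)
          · have := h.four_le x
            simp only [h4, h5, if_false, add_zero]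
            exact (gift_eq_zero_of_six_le (by omega)).le
    _ = _ := by
        rw [sum_add_distrib, ← sum_filter, ← sum_filter, sum_const, sum_const, nsmul_eq_mul,
          nsmul_eq_mul, mul_comm m, mul_comm n]
        rfl

theorem exists_card_low (v x : V) (hx : x ∈ neighborsOfDegree G v 4) :
    ∃ s : Finset V, (∀ y ∈ s, G.Adj v y ∧ G.degree y ≤ 5) ∧ x ∉ s ∧
      s.card + 1 = (neighborsOfDegree G v 4).card + (neighborsOfDegree G v 5).card := by
  have hdis : Disjoint (neighborsOfDegree G v 4) (neighborsOfDegree G v 5) := by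
    rw [Finset.disjoint_left]
    intro y h4 h5
    rw [mem_neighborsOfDegree] at h4 h5
    omega
  refine ⟨(neighborsOfDegree G v 4 ∪ neighborsOfDegree G v 5).erase x, fun y hy => ?_, by simp, ?_⟩
  · rw [mem_erase, mem_union, mem_neighborsOfDegree, mem_neighborsOfDegree] at hy
    rcases hy.2 with hh | hh
    · exact ⟨hh.1, by omega⟩
    · exact ⟨hh.1, by omega⟩
  · rw [card_erase_add_one (mem_union_left _ hx), card_union_of_disjoint hdis]

theorem exists_four_ne {v x : V} (h2 : 2 ≤ (neighborsOfDegree G v 4).card) :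
    ∃ y, y ≠ x ∧ G.Adj v y ∧ G.degree y = 4 := by
  obtain ⟨y, hy, hyx⟩ := exists_mem_ne (s := neighborsOfDegree G v 4) (by omega) x
  exact ⟨y, hyx, mem_neighborsOfDegree.1 hy⟩

theorem exists_low_of_card {v x : V} (hx : x ∈ neighborsOfDegree G v 4) (t : Finset V)
    (h : t.card + 2 ≤ (neighborsOfDegree G v 4).card + (neighborsOfDegree G v 5).card) :
    ∃ y, y ≠ x ∧ y ∉ t ∧ G.Adj v y ∧ G.degree y ≤ 5 := by
  obtain ⟨s, hs, hxs, hc⟩ := exists_card_low v x hx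
  obtain ⟨y, hy, hyt⟩ := exists_mem_notMem_of_card_lt_card (s := t) (t := s) (by omega)
  exact ⟨y, fun hh => hxs (hh ▸ hy), hyt, hs y hy⟩

/-- The extremes are three 5s (`Q11`), one 4 and one 5 (`40 + 20`), and two 4s, where `Q9` lowers
the gifts to 30. -/
theorem sum_gift_seven (h : IsFree G F) {v : V} (hv : G.degree v = 7) :
    ∑ x ∈ G.neighborFinset v, gift G F v x ≤ 60 := by
  have five : ∀ x ∈ neighborsOfDegree G v 5, gift G F v x ≤ 20 := fun x hx =>
    gift_five_le_twenty (mem_neighborsOfDegree.1 hx).2 hv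
  have s40 := h.sum_gift_le (v := v) (m := 40) (fun x _ => gift_seven_le hv) five
  rcases (neighborsOfDegree G v 4).eq_empty_or_nonempty with he | ⟨x, hx⟩
  · have := h.card_five_at_seven hv (s := neighborsOfDegree G v 5) fun x => mem_neighborsOfDegree.1
    rw [he, card_empty] at s40
    push_cast at s40
    omega
  · have hx' := mem_neighborsOfDegree.1 hx
    have hpos := card_pos.2 ⟨x, hx⟩
    obtain ⟨s, hs, hxs, hc⟩ := exists_card_low v x hx
    have := h.card_low_at_seven hv hx'.2 hx'.1 hs hxs
    by_cases h2 : 2 ≤ (neighborsOfDegree G v 4).card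
    · have s30 := h.sum_gift_le (v := v) (m := 30) (fun y hy => by
        by_contra hg
        obtain ⟨w, hw, hw6⟩ := faceDegree_of_gift_seven hv (not_le.1 hg)
        obtain ⟨z, hzy, hvz, hz⟩ := exists_four_ne (v := v) (x := y) h2
        exact h.no_four_at_seven_four_six hv (mem_neighborsOfDegree.1 hy).2 hw6 hz hw hvz
          hzy.symm) five
      omega
    · omega

theorem sum_gift_eight (h : IsFree G F) {v : V} (hv : G.degree v = 8) :
    ∑ x ∈ G.neighborFinset v, gift G F v x ≤ 120 := by
  have five : ∀ x ∈ neighborsOfDegree G v 5, gift G F v x ≤ 30 := fun x hx =>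
    gift_five_le (mem_neighborsOfDegree.1 hx).2
  have s80 := h.sum_gift_le (v := v) (m := 80) (fun x _ => gift_le_eighty v x) five
  rcases (neighborsOfDegree G v 4).eq_empty_or_nonempty with he | ⟨x, hx⟩
  · have := h.card_five_at_eight hv (s := neighborsOfDegree G v 5) fun x => mem_neighborsOfDegree.1
    rw [he, card_empty] at s80
    push_cast at s80
    omega
  · have hx' := mem_neighborsOfDegree.1 hx
    have hpos := card_pos.2 ⟨x, hx⟩
    obtain ⟨s, hs, hxs, hc⟩ := exists_card_low v x hx
    have := h.card_low_at_eight hv hx'.2 hx'.1 hs hxs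
    -- Gifts of 80 are excluded by `Q16` if there is a second 4, and by `Q15` if there are two
    -- further low neighbours.
    have s60 : (2 ≤ (neighborsOfDegree G v 4).card ∨
        3 ≤ (neighborsOfDegree G v 4).card + (neighborsOfDegree G v 5).card) → _ := fun hh =>
      h.sum_gift_le (v := v) (m := 60) (fun y hy => by
        have hy' := mem_neighborsOfDegree.1 hy
        by_contra hg
        obtain ⟨p, q, r, hW⟩ := h.exists_heavyWheel hy'.1 (not_le.1 hg)
        rcases hh with hh | hh
        · obtain ⟨z, hzy, hvz, hz⟩ := exists_four_ne (v := v) (x := y) hh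
          exact h.no_heavyWheel_eight_four hv hW hz hvz hzy.symm
        · obtain ⟨z, hzy, _, hvz, hz⟩ := exists_low_of_card hy ∅ (by rw [card_empty]; omega)
          obtain ⟨w, hwy, hwz, hvw, hw⟩ := exists_low_of_card hy {z} (by
            rw [card_singleton]; omega)
          exact h.no_heavyWheel_eight_low hv hW hz hvz hw hvw hzy.symm hwy.symm
            fun e => hwz (by simp [e])) five
    -- With two 4s among three low neighbours, `Q14` forbids a 6 on a face with a 4, hence gifts
    -- above 40.
    have s40 : (2 ≤ (neighborsOfDegree G v 4).card ∧
        3 ≤ (neighborsOfDegree G v 4).card + (neighborsOfDegree G v 5).card) → _ := fun hh =>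
      h.sum_gift_le (v := v) (m := 40) (fun y hy => by
        have hy' := mem_neighborsOfDegree.1 hy
        by_contra hg
        obtain ⟨u, hu, hu6⟩ := faceDegree_of_gift (not_le.1 hg)
        obtain ⟨z, hzy, hvz, hz⟩ := exists_four_ne (v := v) (x := y) hh.1
        obtain ⟨w, hwy, hwz, hvw, hw⟩ := exists_low_of_card hy {z} (by
          rw [card_singleton]; omega)
        exact h.no_eight_four_six hv hy'.2 hu6 hu hz hvz hw hvw hzy.symm hwy.symm
          fun e => hwz (by simp [e])) five
    omega

theorem sum_gift_nine (h : IsFree G F) {v : V} (hv : G.degree v = 9) :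
    ∑ x ∈ G.neighborFinset v, gift G F v x ≤ 180 := by
  have five : ∀ x ∈ neighborsOfDegree G v 5, gift G F v x ≤ 30 := fun x hx =>
    gift_five_le (mem_neighborsOfDegree.1 hx).2
  rcases (neighborsOfDegree G v 4).eq_empty_or_nonempty with he | ⟨x, hx⟩
  · obtain ⟨_, c, hc⟩ := h.tri.exists_rotation v hv
    rw [hc.sum_neighborFinset]
    -- No configuration bounds the number of 5-neighbours here; the average of 20 per slot meets the
    -- budget 180 exactly.
    exact ((h.linkData le_rfl hc).sum_le_of_no_four fun i h4 => Finset.notMem_empty (c i)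
      (he ▸ mem_neighborsOfDegree.2 ⟨hc.adj i, h4⟩)).trans (by norm_num)
  · have s80 := h.sum_gift_le (v := v) (m := 80) (fun x _ => gift_le_eighty v x) five
    have hx' := mem_neighborsOfDegree.1 hx
    have hpos := card_pos.2 ⟨x, hx⟩
    obtain ⟨s, hs, hxs, hc⟩ := exists_card_low v x hx
    have := h.card_low_at_nine hv hx'.2 hx'.1 hs hxs
    -- `Q21` excludes gifts of 80 here; `Q19` excludes gifts above 40 below.
    have s60 : (2 ≤ (neighborsOfDegree G v 4).card ∧
        3 ≤ (neighborsOfDegree G v 4).card + (neighborsOfDegree G v 5).card) → _ := fun hh =>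
      h.sum_gift_le (v := v) (m := 60) (fun y hy => by
        have hy' := mem_neighborsOfDegree.1 hy
        by_contra hg
        obtain ⟨p, q, r, hW⟩ := h.exists_heavyWheel hy'.1 (not_le.1 hg)
        obtain ⟨z, hzy, hvz, hz⟩ := exists_four_ne (v := v) (x := y) hh.1
        obtain ⟨w, hwy, hwz, hvw, hw⟩ := exists_low_of_card hy {z} (by
          rw [card_singleton]; omega)
        exact h.no_heavyWheel_nine hv hW hz hvz hw hvw hzy.symm hwy.symm
          fun e => hwz (by simp [e])) five
    have s40 : (3 ≤ (neighborsOfDegree G v 4).card ∧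
        4 ≤ (neighborsOfDegree G v 4).card + (neighborsOfDegree G v 5).card) → _ := fun hh =>
      h.sum_gift_le (v := v) (m := 40) (fun y hy => by
        have hy' := mem_neighborsOfDegree.1 hy
        by_contra hg
        obtain ⟨u, hu, hu6⟩ := faceDegree_of_gift (not_le.1 hg)
        obtain ⟨z, hzy, hvz, hz⟩ := exists_four_ne (x := y) (le_of_lt hh.1)
        obtain ⟨z', hz', hzz⟩ := exists_mem_notMem_of_card_lt_card (s := {y, z})
          (t := neighborsOfDegree G v 4) (lt_of_le_of_lt card_le_two hh.1)
        rw [mem_neighborsOfDegree] at hz'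
        have hc2 := card_le_two (a := z) (b := z')
        obtain ⟨w, hwy, hwz, hvw, hw⟩ := exists_low_of_card hy {z, z'} (by omega)
        simp only [mem_insert, mem_singleton, not_or] at hzz hwz
        refine h.no_nine_four_six hv hy'.2 hu6 hu hz hvz hz'.2 hz'.1 hw hvw ?_
        simp only [List.nodup_cons, List.mem_cons, List.not_mem_nil, or_false, not_or,
          List.nodup_nil, not_false_eq_true, and_true]
        exact ⟨⟨hzy.symm, Ne.symm hzz.1, hwy.symm⟩, ⟨Ne.symm hzz.2, Ne.symm hwz.1⟩,
          Ne.symm hwz.2⟩) five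
    omega

/-- Every vertex of a triangulation without the configurations ends up with nonnegative charge. -/
theorem charge_nonneg (h : IsFree G F) (v : V) :
    0 ≤ 60 * ((G.degree v : ℤ) - 6) - ∑ x ∈ G.neighborFinset v, gift G F v x +
      ∑ x ∈ G.neighborFinset v, gift G F x v := by
  have hrec : 0 ≤ ∑ x ∈ G.neighborFinset v, gift G F x v := sum_nonneg fun x _ => gift_nonneg x v
  have hlow : G.degree v ≤ 6 → ∑ x ∈ G.neighborFinset v, gift G F v x = 0 := fun h6 =>
    sum_eq_zero fun x _ => gift_eq_zero_of_le_six h6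
  have h4 := h.four_le v
  rcases Nat.lt_or_ge (G.degree v) 10 with hlt | hge
  · obtain hd | hd | hd | hd | hd | hd : G.degree v = 4 ∨ G.degree v = 5 ∨ G.degree v = 6 ∨
        G.degree v = 7 ∨ G.degree v = 8 ∨ G.degree v = 9 := by omega
    · have := h.four_receives hd
      have := hlow (by omega)
      omega
    · have := h.five_receives hd
      have := hlow (by omega)
      omega
    · have := hlow (by omega)
      omega
    · have := h.sum_gift_seven hd
      omega
    · have := h.sum_gift_eight hd
      omega
    · have := h.sum_gift_nine hd
      omega
  · have := h.sum_gift_of_ten_le hge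
    omega

/-- Gifts given and received cancel in the sum of all final charges, which leaves `-360` times the
Euler characteristic. -/
theorem eulerChar_nonpos (h : IsFree G F) : eulerChar G F ≤ 0 := by
  have hsum := sum_nonneg fun v (_ : v ∈ univ) => h.charge_nonneg v
  have hswap : ∑ v, ∑ x ∈ G.neighborFinset v, gift G F v x =
      ∑ v, ∑ x ∈ G.neighborFinset v, gift G F x v :=
    sum_comm' fun x y => by simp [G.adj_comm]
  rw [sum_add_distrib, sum_sub_distrib, hswap, sub_add_cancel, ← mul_sum,
    h.tri.sum_degree_sub_six] at hsum
  omega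

end IsFree
end Charge
end Triang

theorem theorem2p1 {V : Type*} [Fintype V] [DecidableEq V] (G : SimpleGraph V)
    [DecidableRel G.Adj] (F : Finset (Finset V))
    (hT : Triang.IsPlaneTriangulation G F ∨ Triang.IsProjectivePlaneTriangulation G F) :
    ∃ Q ∈ Triang.unavoidable, Triang.ContainsDrawing G F Q := by
  by_contra hQ
  push Not at hQ
  rcases hT with ⟨hT, he⟩ | ⟨hT, he⟩
  · have := (Triang.IsFree.mk hT hQ).eulerChar_nonpos
    omega
  · have := (Triang.IsFree.mk hT hQ).eulerChar_nonpos
    omega
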